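/- **Setting.** All functions are defined on the Hilbert space $\ell_2$. A differentiable $h:\ell_2\to\mathbb R$ is $L$-smooth if $\|\nabla h(y)-\nabla h(x)\|\le L\|y-x\|$ for all $x,y$, and $\mu$-strongly convex if $h(y)\ge h(x)+\langle\nabla h(x),y-x\rangle+\frac\mu2\|y-x\|^2$ for all $x,y$. A decentralized time-varying problem $P$ consists of a sequence of connected graphs $G_0,G_1,\dots$ on a common vertex set $\{1,\dots,n\}$ and functions $f_1,\dots,f_n:\ell_2\to\mathbb R$, with global function $f=\frac1n\sum_i f_i$. Let $\chi(G)$ be the ratio of the largest to the smallest positive eigenvalue of the Laplacian of $G$, $\chi=\chi(P)=\sup_t\chi(G_t)$, and let $\Delta(P)=\max_t|E(G_t)\,\triangle\,E(G_{t+1})|$. *First-order decentralized algorithms.* Each node $i$ has memories $\mathcal H_i(0),\mathcal H_i(1),\dots\subseteq\ell_2$ with $\mathcal H_i(0)=\{0\}$ (so $x_0=0$). Each step $t\to t+1$ is either a local computation, $\mathcal H_i(t+1)\subseteq\operatorname{span}\{x,\nabla f_i(x),\nabla f_i^*(x):x\in\mathcal H_i(t)\}$ for all $i$, where $f_i^*$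 is the convex conjugate, or a communication round, $\mathcal H_i(t+1)\subseteq\operatorname{span}\bigcup_{j}\mathcal H_j(t)$ for all $i$, where $j$ runs over $i$ and its neighbours in the current graph $G_{c_t}$. Here $c_0=0$, $c_{t+1}=c_t+1$ after a communication round, and $c_{t+1}\in\{c_t,c_t+1\}$ after a local computation; thus $c_t\le t$. If the network changes at communication rounds only, then $c_t$ is the number of communication rounds among the first $t$ steps; if it changes at every step, then $c_t=t$. The output $x_p$ is any element of any $\mathcal H_i(p)$. *Iterated-path trees.* $H_{1,k}$ is a path with $k$ vertices, and its last vertex is its root; $H_{d+1,k}$ is a path with $k$ vertices, the last of them being the root, together with $k$ copies of $H_{d,k}$, one for every vertex of the path, the root of each copy being joined by an edge to its path vertex. **Theorem.** For every integer $d\ge1$ there are constants $K(d),c(d),\varepsilon_0(d)>0$ such that for all $L\ge\mu>0$ and all $M$ there is a decentralized time-varying problem $P$ with the following properties. 1. All $f_i$, and hence $f$, are $L$-smooth and $\mu$-strongly convex. 2. $n>M$, $\chi>M$, $\Delta(P)\le12(d-1)$, and for some $k$ all graphs $G_t$ are isomorphic to $H_{d,k}$. 3. The minimizer $x_*$ of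 $f$ is different from $x_0=0$, and for every first-order decentralized algorithm, every $p$ and every output $x_p$, $$\|x_p-x_*\|^2\ \ge\ \max\Bigl\{0,\,1-2\sqrt6\sqrt{\tfrac{\mu}{L}}\Bigr\}^{K(d)\,c_p\,\chi^{-d/(d+1)}+2}\ \|x_0-x_*\|^2 ,$$ and therefore the same with $p$ in place of $c_p$. (The bound is non-trivial exactly when $L/\mu>24$.) 4. If $L/\mu>24$, then for every first-order decentralized algorithm and every $0<\varepsilon\le\varepsilon_0(d)$, an output with $\|x_p-x_*\|^2\le\varepsilon\|x_0-x_*\|^2$ requires $$c_p\ \ge\ c(d)\,\chi^{d/(d+1)}\sqrt{L/\mu}\,\log\frac1\varepsilon .$$ In particular the number of communication rounds is $\Omega\bigl(\chi^{d/(d+1)}\sqrt{L/\mu}\,\log(1/\varepsilon)\bigr)$ when the network changes at communication rounds only. -/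

import Mathlib

/-- The real Hilbert space `ℓ₂` of square summable sequences. -/
abbrev EllTwo : Type := lp (fun _ : ℕ => ℝ) 2

/-- `h` is `L`-smooth: differentiable with `L`-Lipschitz gradient. -/
def LSmooth (L : ℝ) (h : EllTwo → ℝ) : Prop :=
  Differentiable ℝ h ∧ ∀ x y : EllTwo, ‖gradient h y - gradient h x‖ ≤ L * ‖y - x‖

/-- `h` is (differentiable and) `μ`-strongly convex. -/
def MuStronglyConvex (μ : ℝ) (h : EllTwo → ℝ) : Prop :=
  Differentiable ℝ h ∧ ∀ x y : EllTwo,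
    h x + inner ℝ (gradient h x) (y - x) + μ / 2 * ‖y - x‖ ^ 2 ≤ h y

/-- The convex (Fenchel) conjugate `f*(y) = sup_x (⟨y, x⟩ - f x)`. The supremum is finite for every
`y` whenever `f` is strongly convex, which is the only case in which it is used below. -/
noncomputable def fenchelConjugate (f : EllTwo → ℝ) (y : EllTwo) : ℝ :=
  ⨆ x : EllTwo, (inner ℝ y x - f x)

open scoped Classical in
/-- Spectrum (set of eigenvalues) of the Laplacian of a graph on `n` vertices. -/
noncomputable def laplacianSpectrum {n : ℕ} (G : SimpleGraph (Fin n)) : Set ℝ :=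
  spectrum ℝ (G.lapMatrix ℝ)

/-- Condition number `χ(G) = λ_max / λ_min⁺` of the Laplacian of `G`, where `λ_min⁺` is the least
positive eigenvalue. -/
noncomputable def graphCondition {n : ℕ} (G : SimpleGraph (Fin n)) : ℝ :=
  sSup (laplacianSpectrum G) / sInf {t | t ∈ laplacianSpectrum G ∧ 0 < t}

/-- A decentralized time-varying problem: a sequence of connected graphs on the common vertex set
`Fin n` and one objective function for every vertex. -/
structure DecentralizedProblem where
  n : ℕ
  graph : ℕ → SimpleGraph (Fin n)
  connected : ∀ t, (graph t).Connected
  f : Fin n → EllTwo → ℝ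

namespace DecentralizedProblem

/-- The global function `f = (1/n) ∑ f_i`. -/
noncomputable def globalFun (P : DecentralizedProblem) (x : EllTwo) : ℝ :=
  (1 / (P.n : ℝ)) * ∑ i, P.f i x

/-- `χ(P) = sup_t χ(G_t)`. There are finitely many graphs on `Fin n`, so the supremum is finite. -/
noncomputable def chi (P : DecentralizedProblem) : ℝ :=
  ⨆ t : ℕ, graphCondition (P.graph t)

/-- `Δ(P)`: the maximal number of edges in which two consecutive graphs differ. -/
noncomputable def maxChange (P : DecentralizedProblem) : ℕ :=
  ⨆ t : ℕ, (symmDiff (P.graph t).edgeSet (P.graph (t + 1)).edgeSet).ncard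

/-- An execution of a first-order decentralized algorithm on `P`, started at `x₀ = 0`.

`mem t i` is the local memory of node `i` after `t` steps. The step from `t` to `t + 1` is a
communication round if `t ∈ comm` and a local computation otherwise. `clock t` is the index of the
network that is in force at step `t`: it advances by one at every communication round, and at a
local computation it either stands still or advances by one. If it always stands still at local
computations, then `graph q` is the network of the `q`-th communication round and `clock t` is the
number of communication rounds among the first `t` steps; if it always advances, then `graph t` is
the network of time step `t` and `clock t = t`. -/
structure FirstOrderRun (P : DecentralizedProblem) where
  comm : Set ℕ
  clock : ℕ → ℕ
  clock_zero : clock 0 = 0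
  clock_comm : ∀ t, t ∈ comm → clock (t + 1) = clock t + 1
  clock_local : ∀ t, t ∉ comm → clock (t + 1) = clock t ∨ clock (t + 1) = clock t + 1
  mem : ℕ → Fin P.n → Set EllTwo
  mem_zero : ∀ i, mem 0 i = {0}
  mem_local : ∀ t, t ∉ comm → ∀ i, mem (t + 1) i ⊆
    (Submodule.span ℝ {z | ∃ x ∈ mem t i,
      z = x ∨ z = gradient (P.f i) x ∨ z = gradient (fenchelConjugate (P.f i)) x} : Set EllTwo)
  mem_comm : ∀ t, t ∈ comm → ∀ i, mem (t + 1) i ⊆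
    (Submodule.span ℝ {z | ∃ j, (j = i ∨ (P.graph (clock t)).Adj i j) ∧ z ∈ mem t j} : Set EllTwo)

/-- The network clock never exceeds the number of steps. -/
theorem FirstOrderRun.clock_le {P : DecentralizedProblem} (A : P.FirstOrderRun) (p : ℕ) :
    A.clock p ≤ p := by
  induction p with
  | zero => exact A.clock_zero.le
  | succ p ih =>
    by_cases h : p ∈ A.comm
    · have := A.clock_comm p h
      omega
    · have := A.clock_local p h
      omega

end DecentralizedProblem

/-- Vertices of the iterated-path tree `H_{d,k}`: those of `H_{d+1,k}` are the vertices of a path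
with `k` vertices and those of `k` copies of `H_{d,k}`, one for each path vertex. It is convenient
to start from the empty graph `H_{0,k}`, so that `H_{1,k}` is the path with `k` vertices. -/
def TreeVertex (k : ℕ) : ℕ → Type
  | 0 => Empty
  | d + 1 => Fin k ⊕ (Fin k × TreeVertex k d)

/-- The root of `H_{d,k}` is the last vertex of its outermost path. -/
def TreeIsRoot (k : ℕ) : (d : ℕ) → TreeVertex k d → Prop
  | 0, _ => False
  | _ + 1, .inl i => i.val + 1 = k
  | _ + 1, .inr _ => False

/-- Adjacency in `H_{d,k}`: consecutive path vertices are adjacent, every path vertex is adjacent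
to the root of its copy of `H_{d-1,k}`, and every copy keeps its edges. -/
def TreeAdj (k : ℕ) : (d : ℕ) → TreeVertex k d → TreeVertex k d → Prop
  | 0, _, _ => False
  | _ + 1, .inl i, .inl j => i.val + 1 = j.val ∨ j.val + 1 = i.val
  | d + 1, .inl i, .inr (j, v) => i = j ∧ TreeIsRoot k d v
  | d + 1, .inr (i, u), .inl j => i = j ∧ TreeIsRoot k d u
  | d + 1, .inr (i, u), .inr (j, v) => i = j ∧ TreeAdj k d u v

theorem TreeAdj.symm' (k : ℕ) : ∀ (d : ℕ) (u v : TreeVertex k d),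
    TreeAdj k d u v → TreeAdj k d v u
  | 0, _, _, h => h
  | _ + 1, .inl _, .inl _, h => Or.symm h
  | _ + 1, .inl _, .inr (_, _), h => ⟨h.1.symm, h.2⟩
  | _ + 1, .inr (_, _), .inl _, h => ⟨h.1.symm, h.2⟩
  | d + 1, .inr (_, u), .inr (_, v), h => ⟨h.1.symm, TreeAdj.symm' k d u v h.2⟩

theorem TreeAdj.irrefl' (k : ℕ) : ∀ (d : ℕ) (u : TreeVertex k d), ¬ TreeAdj k d u u
  | 0, _, h => h
  | _ + 1, .inl i, h => by
      rcases h with h | h <;> omega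
  | d + 1, .inr (_, u), h => TreeAdj.irrefl' k d u h.2

/-- The iterated-path tree `H_{d,k}`. -/
def iteratedPathTree (d k : ℕ) : SimpleGraph (TreeVertex k d) where
  Adj := TreeAdj k d
  symm := ⟨fun u v h => TreeAdj.symm' k d u v h⟩
  loopless := ⟨fun u h => TreeAdj.irrefl' k d u h⟩

/-! Write `D` for the depth of the trees; most lemmas below use `D = d + 1`.

The objective is Nesterov's chain, split between two distant groups of nodes. The first quarter of
the nodes couples the coordinates `2j + 1` and `2j + 2` and carries the linear term, the last
quarter couples `2j` and `2j + 1`, and the nodes in between only contribute `μ/2 ‖x‖²`. The average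
is a tridiagonal quadratic whose minimizer is a geometric sequence `q ^ j`
(`average_node_apply_geomSeq`). Gradients and conjugate gradients of the first group preserve
`levelSpace r` for odd `r`, those of the last group for even `r` (`node_levelSpace`). So two further
coordinates cost a passage of information from the front group to the end group.

The network makes this passage take `T = n / (4D)` rounds, although the trees have diameter of order
`k` only. In a depth-first order of the tree, an initial segment has at most `D` outside neighbours:
the next vertex and at most `D - 1` later ones (`ncard_farSet_le`). After each round the nodes on
these later positions are moved right behind the segment (`exists_shift`). The informed nodes thus
stay in an initial segment that grows by `D` positions per round, while few nodes of bounded degree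
move. After `T` rounds all levels rise by two and the front is reset (`exists_slow_network`).

After `c` clock ticks an iterate has at most `2⌊c/T⌋ + 1` nonzero coordinates, so the tail of the
geometric sequence bounds the error from below, with `q = exp (-u)` and `u ≤ 3√(μ/L)`
(`exists_decay_rate`). Finally `χ = O(nk)` (`graphCondition_le`) and `k ^ D ≤ n` give `χ ^ (D/(D+1))
= O(n) = O(T)` (`rpow_chi_le`). -/

/-! ### Quadratic functions and gradients of their conjugates. -/

section Quadratic

/-- The quadratic function `x ↦ ⟨A x, x⟩ / 2 - ⟨c, x⟩`. -/
noncomputable def quadraticFun (A : EllTwo →L[ℝ] EllTwo) (c x : EllTwo) : ℝ :=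
  1 / 2 * inner ℝ (A x) x - inner ℝ c x

variable {A : EllTwo →L[ℝ] EllTwo} {c : EllTwo}

theorem quadraticFun_expand (hA : ∀ x y, inner ℝ (A x) y = inner ℝ x (A y)) (x y : EllTwo) :
    quadraticFun A c y = quadraticFun A c x + inner ℝ (A x - c) (y - x) +
      1 / 2 * inner ℝ (A (y - x)) (y - x) := by
  have h1 := hA y x
  have h2 := real_inner_comm y (A x)
  simp only [quadraticFun, map_sub, inner_sub_left, inner_sub_right]
  linarith

theorem hasGradientAt_quadraticFun (hA : ∀ x y, inner ℝ (A x) y = inner ℝ x (A y)) (x : EllTwo) :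
    HasGradientAt (quadraticFun A c) (A x - c) x := by
  rw [hasGradientAt_iff_hasFDerivAt]
  have h1 : HasFDerivAt (fun y : EllTwo => inner ℝ (A y) y) _ x :=
    (A.hasFDerivAt (x := x)).inner ℝ (hasFDerivAt_id x)
  have h2 : HasFDerivAt (fun y : EllTwo => inner ℝ c y) _ x := (innerSL ℝ c).hasFDerivAt
  refine ((h1.const_mul (1 / 2)).sub h2).congr_fderiv ?_
  ext y
  have h3 := hA y x
  have h4 := real_inner_comm y (A x)
  simp [fderivInnerCLM_apply]
  linarith

theorem gradient_quadraticFun (hA : ∀ x y, inner ℝ (A x) y = inner ℝ x (A y)) (x : EllTwo) :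
    gradient (quadraticFun A c) x = A x - c :=
  (hasGradientAt_quadraticFun hA x).gradient

theorem lSmooth_quadraticFun {L : ℝ} (hA : ∀ x y, inner ℝ (A x) y = inner ℝ x (A y))
    (hL : ‖A‖ ≤ L) : LSmooth L (quadraticFun A c) := by
  refine ⟨fun x => (hasGradientAt_quadraticFun hA x).differentiableAt, fun x y => ?_⟩
  rw [gradient_quadraticFun hA, gradient_quadraticFun hA, sub_sub_sub_cancel_right, ← map_sub]
  exact (A.le_opNorm _).trans (mul_le_mul_of_nonneg_right hL (norm_nonneg _))

theorem muStronglyConvex_quadraticFun {μ : ℝ} (hA : ∀ x y, inner ℝ (A x) y = inner ℝ x (A y))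
    (hμ : ∀ x, μ * ‖x‖ ^ 2 ≤ inner ℝ (A x) x) : MuStronglyConvex μ (quadraticFun A c) := by
  refine ⟨fun x => (hasGradientAt_quadraticFun hA x).differentiableAt, fun x y => ?_⟩
  rw [gradient_quadraticFun hA, quadraticFun_expand hA x y]
  linarith [hμ (y - x)]

theorem quadraticFun_le_of_apply_eq {μ : ℝ} (h0 : 0 ≤ μ)
    (hA : ∀ x y, inner ℝ (A x) y = inner ℝ x (A y))
    (hμ : ∀ x, μ * ‖x‖ ^ 2 ≤ inner ℝ (A x) x) {x : EllTwo} (hx : A x = c) (y : EllTwo) :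
    quadraticFun A c x ≤ quadraticFun A c y := by
  rw [quadraticFun_expand hA x y, hx, sub_self, inner_zero_left]
  have := hμ (y - x)
  have : 0 ≤ μ * ‖y - x‖ ^ 2 := by positivity
  linarith

theorem eq_gradient_of_subgradient {h : EllTwo → ℝ} {x y : EllTwo} (hd : DifferentiableAt ℝ h y)
    (hs : ∀ z, h y + inner ℝ x (z - y) ≤ h z) : gradient h y = x := by
  have h1 := hd.hasGradientAt
  have h2 : HasFDerivAt (fun z : EllTwo => h z - inner ℝ x (z - y)) _ y :=
    (hasGradientAt_iff_hasFDerivAt.1 h1).sub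
      ((innerSL ℝ x).hasFDerivAt.comp y ((hasFDerivAt_id y).sub_const y))
  have h3 : IsLocalMin (fun z : EllTwo => h z - inner ℝ x (z - y)) y := by
    refine Filter.Eventually.of_forall fun z => ?_
    have := hs z
    simp
    linarith
  have h4 := h3.hasFDerivAt_eq_zero h2
  rw [← sub_eq_zero]
  refine ext_inner_right ℝ fun z => ?_
  have := congrArg (fun F : EllTwo →L[ℝ] ℝ => F z) h4
  simpa [inner_sub_left] using this

/-- Coercivity makes `A` injective, hence surjective on a finite-dimensional invariant subspace:
solving with `A` does not leave `V`. -/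
theorem exists_mem_apply_eq {μ : ℝ} (h0 : 0 < μ) (hμ : ∀ x, μ * ‖x‖ ^ 2 ≤ inner ℝ (A x) x)
    (V : Submodule ℝ EllTwo) [FiniteDimensional ℝ V] (hV : ∀ x ∈ V, A x ∈ V) {y : EllTwo}
    (hy : y ∈ V) : ∃ x ∈ V, A x = y := by
  let F : V →ₗ[ℝ] V := (A : EllTwo →ₗ[ℝ] EllTwo).restrict hV
  have hF : Function.Injective F := by
    rw [injective_iff_map_eq_zero]
    intro x hx
    have h1 : A x = 0 := congrArg Subtype.val hx
    have h2 := hμ x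
    rw [h1, inner_zero_left] at h2
    have h3 : ‖(x : EllTwo)‖ ^ 2 ≤ 0 := by
      by_contra! h
      have := mul_pos h0 h
      linarith
    have h4 : ‖(x : EllTwo)‖ = 0 := by
      have := sq_nonneg ‖(x : EllTwo)‖
      exact pow_eq_zero_iff (two_ne_zero) |>.1 (le_antisymm h3 this)
    exact Subtype.ext (norm_eq_zero.1 h4)
  obtain ⟨x, hx⟩ := (LinearMap.injective_iff_surjective.1 hF) ⟨y, hy⟩
  exact ⟨x, x.2, congrArg Subtype.val hx⟩

/-- The maximizer `A⁻¹(y + c)` in the supremum is a subgradient of the conjugate at `y`, so it is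
the gradient if there is one. Differentiability need not be proved, because `gradient` defaults to
`0 ∈ V` otherwise. -/
theorem gradient_fenchelConjugate_mem {μ : ℝ} (h0 : 0 < μ)
    (hA : ∀ x y, inner ℝ (A x) y = inner ℝ x (A y)) (hμ : ∀ x, μ * ‖x‖ ^ 2 ≤ inner ℝ (A x) x)
    (V : Submodule ℝ EllTwo) [FiniteDimensional ℝ V] (hV : ∀ x ∈ V, A x ∈ V) (hc : c ∈ V)
    {y : EllTwo} (hy : y ∈ V) : gradient (fenchelConjugate (quadraticFun A c)) y ∈ V := by
  by_cases hd : DifferentiableAt ℝ (fenchelConjugate (quadraticFun A c)) y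
  swap
  · rw [gradient_eq_zero_of_not_differentiableAt hd]
    exact V.zero_mem
  have hq : ∀ x z : EllTwo, inner ℝ z x - quadraticFun A c x = -quadraticFun A (z + c) x := by
    intro x z
    simp only [quadraticFun, inner_add_left]
    ring
  have hbdd : ∀ z : EllTwo,
      BddAbove (Set.range fun x : EllTwo => inner ℝ z x - quadraticFun A c x) := by
    intro z
    refine ⟨‖z + c‖ ^ 2 / (2 * μ), ?_⟩
    rintro _ ⟨x, rfl⟩
    have h1 := hμ x
    have h2 := real_inner_le_norm (z + c) x
    rw [le_div_iff₀ (by positivity)]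
    have h3 := mul_le_mul_of_nonneg_left h2 h0.le
    have h4 := mul_le_mul_of_nonneg_left h1 h0.le
    have h5 := sq_nonneg (‖z + c‖ - μ * ‖x‖)
    change (inner ℝ z x - quadraticFun A c x) * (2 * μ) ≤ _
    rw [hq, quadraticFun]
    linarith
  obtain ⟨x, hxV, hx⟩ := exists_mem_apply_eq h0 hμ V hV (V.add_mem hy hc)
  have hmax : fenchelConjugate (quadraticFun A c) y = inner ℝ y x - quadraticFun A c x := by
    refine le_antisymm (ciSup_le fun w => ?_) (le_ciSup (hbdd y) x)
    rw [hq, hq, neg_le_neg_iff]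
    exact quadraticFun_le_of_apply_eq h0.le hA hμ hx w
  rw [eq_gradient_of_subgradient hd (x := x)]
  · exact hxV
  · intro z
    have := le_ciSup (hbdd z) x
    have h1 := real_inner_comm x z
    have h2 := real_inner_comm x y
    rw [hmax, inner_sub_right, fenchelConjugate]
    linarith

end Quadratic

/-! ### Coordinate swaps, level spaces and the geometric minimizer. -/

section Coordinates

theorem EllTwo.norm_sq_eq_tsum (x : EllTwo) : ‖x‖ ^ 2 = ∑' j, x j ^ 2 := by
  rw [← real_inner_self_eq_norm_sq, lp.inner_eq_tsum]
  exact tsum_congr fun j => by simp [sq]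

theorem EllTwo.summable_sq (x : EllTwo) : Summable fun j => x j ^ 2 := by
  have := lp.summable_inner (𝕜 := ℝ) x x
  simpa [sq] using this

theorem memℓp_two_of_summable_sq {x : ℕ → ℝ} (hx : Summable fun j => x j ^ 2) :
    Memℓp (E := fun _ : ℕ => ℝ) x 2 :=
  memℓp_gen (by simpa using hx)

/-- Permutation of the coordinates of `ℓ₂`. -/
noncomputable def coordPerm (τ : Equiv.Perm ℕ) : EllTwo →L[ℝ] EllTwo :=
  LinearMap.mkContinuous
    { toFun := fun x => ⟨fun j => x (τ j), memℓp_two_of_summable_sq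
        ((Equiv.summable_iff τ).2 x.summable_sq)⟩
      map_add' := fun x y => rfl
      map_smul' := fun r x => rfl } 1 fun x => by
    rw [one_mul, ← sq_le_sq₀ (norm_nonneg _) (norm_nonneg _), EllTwo.norm_sq_eq_tsum,
      EllTwo.norm_sq_eq_tsum]
    exact (Equiv.tsum_eq τ fun j => x j ^ 2).le

@[simp]
theorem coordPerm_apply (τ : Equiv.Perm ℕ) (x : EllTwo) (j : ℕ) : coordPerm τ x j = x (τ j) := rfl

theorem norm_coordPerm_apply (τ : Equiv.Perm ℕ) (x : EllTwo) : ‖coordPerm τ x‖ = ‖x‖ := by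
  rw [← sq_eq_sq₀ (norm_nonneg _) (norm_nonneg _), EllTwo.norm_sq_eq_tsum,
    EllTwo.norm_sq_eq_tsum]
  exact Equiv.tsum_eq τ fun j => x j ^ 2

theorem inner_coordPerm_left {τ : Equiv.Perm ℕ} (hτ : Function.Involutive τ) (x y : EllTwo) :
    inner ℝ (coordPerm τ x) y = inner ℝ x (coordPerm τ y) := by
  rw [lp.inner_eq_tsum, lp.inner_eq_tsum,
    ← Equiv.tsum_eq τ fun j => inner ℝ (x j) (coordPerm τ y j)]
  exact tsum_congr fun j => by simp [hτ j]

/-- The operator `μ + a (1 - T)`, where `T` permutes the coordinates. -/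
noncomputable def swapOp (μ a : ℝ) (τ : Equiv.Perm ℕ) : EllTwo →L[ℝ] EllTwo :=
  (μ + a) • ContinuousLinearMap.id ℝ EllTwo - a • coordPerm τ

theorem swapOp_apply (μ a : ℝ) (τ : Equiv.Perm ℕ) (x : EllTwo) :
    swapOp μ a τ x = (μ + a) • x - a • coordPerm τ x := rfl

theorem swapOp_apply_coord (μ a : ℝ) (τ : Equiv.Perm ℕ) (x : EllTwo) (j : ℕ) :
    swapOp μ a τ x j = (μ + a) * x j - a * x (τ j) := rfl

theorem inner_swapOp_left {μ a : ℝ} {τ : Equiv.Perm ℕ} (hτ : Function.Involutive τ)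
    (x y : EllTwo) : inner ℝ (swapOp μ a τ x) y = inner ℝ x (swapOp μ a τ y) := by
  simp only [swapOp_apply, inner_sub_left, inner_sub_right, real_inner_smul_left,
    real_inner_smul_right, inner_coordPerm_left hτ]

theorem le_inner_swapOp {μ a : ℝ} (ha : 0 ≤ a) (τ : Equiv.Perm ℕ) (x : EllTwo) :
    μ * ‖x‖ ^ 2 ≤ inner ℝ (swapOp μ a τ x) x := by
  have h := real_inner_le_norm (coordPerm τ x) x
  rw [norm_coordPerm_apply] at h
  rw [swapOp_apply, inner_sub_left, real_inner_smul_left, real_inner_smul_left,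
    real_inner_self_eq_norm_sq]
  nlinarith

theorem norm_swapOp_le {μ a : ℝ} (hμ : 0 ≤ μ) (ha : 0 ≤ a) (τ : Equiv.Perm ℕ) :
    ‖swapOp μ a τ‖ ≤ μ + 2 * a := by
  refine ContinuousLinearMap.opNorm_le_bound _ (by positivity) fun x => ?_
  rw [swapOp_apply]
  refine (norm_sub_le _ _).trans ?_
  rw [norm_smul, norm_smul, norm_coordPerm_apply, Real.norm_of_nonneg ha,
    Real.norm_of_nonneg (add_nonneg hμ ha)]
  linarith

/-- The sequences supported on the first `r` coordinates. -/
def levelSpace (r : ℕ) : Submodule ℝ EllTwo where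
  carrier := {x | ∀ j, r ≤ j → x j = 0}
  add_mem' hx hy j hj := by simp [hx j hj, hy j hj]
  zero_mem' j _ := rfl
  smul_mem' s x hx j hj := by simp [hx j hj]

theorem levelSpace_mono {r s : ℕ} (h : r ≤ s) : levelSpace r ≤ levelSpace s :=
  fun _ hx j hj => hx j (h.trans hj)

instance finiteDimensional_levelSpace (r : ℕ) : FiniteDimensional ℝ (levelSpace r) := by
  let F : levelSpace r →ₗ[ℝ] (Fin r → ℝ) :=
    { toFun := fun x j => (x : EllTwo) j
      map_add' := fun _ _ => rfl
      map_smul' := fun _ _ => rfl }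
  refine FiniteDimensional.of_injective F fun x y h => Subtype.ext (lp.ext (funext fun j => ?_))
  by_cases hj : j < r
  · exact congrFun h ⟨j, hj⟩
  · rw [x.2 j (not_lt.1 hj), y.2 j (not_lt.1 hj)]

theorem swapOp_mem_levelSpace {μ a : ℝ} {τ : Equiv.Perm ℕ} {r : ℕ} (hτ : ∀ j, r ≤ j → r ≤ τ j)
    {x : EllTwo} (hx : x ∈ levelSpace r) : swapOp μ a τ x ∈ levelSpace r := by
  intro j hj
  rw [swapOp_apply_coord, hx j hj, hx _ (hτ j hj)]
  simp

theorem single_zero_mem_levelSpace {r : ℕ} (hr : 0 < r) (s : ℝ) :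
    (lp.single 2 0 s : EllTwo) ∈ levelSpace r := by
  intro j hj
  rw [lp.single_apply_ne]
  omega

/-- The involution that exchanges `2j` and `2j + 1`. -/
def evenSwap : Equiv.Perm ℕ :=
  Function.Involutive.toPerm (fun j => if j % 2 = 0 then j + 1 else j - 1) fun j => by grind

/-- The involution that fixes `0` and exchanges `2j + 1` and `2j + 2`. -/
def oddSwap : Equiv.Perm ℕ :=
  Function.Involutive.toPerm (fun j => if j = 0 then 0 else if j % 2 = 0 then j - 1 else j + 1)
    fun j => by grind

theorem evenSwap_apply (j : ℕ) : evenSwap j = if j % 2 = 0 then j + 1 else j - 1 := rfl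

theorem oddSwap_apply (j : ℕ) :
    oddSwap j = if j = 0 then 0 else if j % 2 = 0 then j - 1 else j + 1 := rfl

theorem involutive_evenSwap : Function.Involutive evenSwap :=
  Function.Involutive.toPerm_involutive _

theorem involutive_oddSwap : Function.Involutive oddSwap :=
  Function.Involutive.toPerm_involutive _

/-- No pair of `evenSwap` straddles an even cut, and no pair of `oddSwap` an odd one. This parity is
what blocks local progress. -/
theorem le_evenSwap {r j : ℕ} (h : 2 * r ≤ j) : 2 * r ≤ evenSwap j := by
  grind [evenSwap_apply]

theorem le_oddSwap {r j : ℕ} (h : 2 * r + 1 ≤ j) : 2 * r + 1 ≤ oddSwap j := by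
  grind [oddSwap_apply]

/-- The geometric sequence `1, q, q², …`. -/
noncomputable def geomSeq {q : ℝ} (h0 : 0 ≤ q) (h1 : q < 1) : EllTwo :=
  ⟨fun j => q ^ j, memℓp_two_of_summable_sq <| by
    simp_rw [← pow_mul, mul_comm _ 2, pow_mul]
    exact summable_geometric_of_lt_one (sq_nonneg q) (by nlinarith)⟩

theorem geomSeq_apply {q : ℝ} (h0 : 0 ≤ q) (h1 : q < 1) (j : ℕ) : geomSeq h0 h1 j = q ^ j := rfl

/-- Beyond coordinate `r` the error is the tail of the geometric sequence, which is `q ^ r` times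
the whole sequence. -/
theorem le_norm_sub_geomSeq {q : ℝ} (h0 : 0 ≤ q) (h1 : q < 1) {r : ℕ} {x : EllTwo}
    (hx : x ∈ levelSpace r) : q ^ (2 * r) * ‖geomSeq h0 h1‖ ^ 2 ≤ ‖x - geomSeq h0 h1‖ ^ 2 := by
  rw [EllTwo.norm_sq_eq_tsum, EllTwo.norm_sq_eq_tsum (x - _), ← tsum_mul_left,
    ← (x - geomSeq h0 h1).summable_sq.sum_add_tsum_nat_add r]
  refine le_add_of_nonneg_of_le (Finset.sum_nonneg fun _ _ => sq_nonneg _) (le_of_eq ?_)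
  refine tsum_congr fun j => ?_
  simp only [lp.coeFn_sub, Pi.sub_apply, hx _ (Nat.le_add_left r j), geomSeq_apply]
  ring

theorem geomSeq_ne_zero {q : ℝ} (h0 : 0 ≤ q) (h1 : q < 1) : geomSeq h0 h1 ≠ 0 := by
  intro h
  have := congrArg (fun x : EllTwo => x 0) h
  simp [geomSeq_apply] at this

end Coordinates

/-! ### Depth-first order, degrees and heights of iterated-path trees. -/

section Tree

/-- The number of vertices of `H_{d,k}`. -/
def treeCard (k : ℕ) : ℕ → ℕ
  | 0 => 0
  | d + 1 => k * (treeCard k d + 1)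

theorem pow_le_treeCard (k : ℕ) : ∀ d, 1 ≤ d → k ^ d ≤ treeCard k d
  | 1, _ => by simp [treeCard]
  | d + 2, _ => by
    have := pow_le_treeCard k (d + 1) (by omega)
    rw [pow_succ', treeCard]
    exact Nat.mul_le_mul_left _ (by omega)

/-- The position of a vertex of `H_{d,k}` in the depth-first order in which every copy of
`H_{d-1,k}` comes immediately before the path vertex to which it is attached. -/
def treePos (k : ℕ) : (d : ℕ) → TreeVertex k d → ℕ
  | 0, v => nomatch v
  | d + 1, .inl i => i.val * (treeCard k d + 1) + treeCard k d
  | d + 1, .inr (i, v) => i.val * (treeCard k d + 1) + treePos k d v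

/-- A vertex of the outermost path of `H_{d+1,k}`. -/
def pathVertex {k d : ℕ} (i : Fin k) : TreeVertex k (d + 1) := .inl i

/-- A vertex of the `i`-th copy of `H_{d,k}` in `H_{d+1,k}`. -/
def copyVertex {k d : ℕ} (i : Fin k) (v : TreeVertex k d) : TreeVertex k (d + 1) := .inr (i, v)

theorem block_lt {k i B r : ℕ} (hi : i < k) (hr : r ≤ B) : i * (B + 1) + r < k * (B + 1) := by
  have : (i + 1) * (B + 1) ≤ k * (B + 1) := Nat.mul_le_mul_right _ hi
  rw [add_one_mul] at this
  omega

theorem block_div {i B r : ℕ} (hr : r ≤ B) : (i * (B + 1) + r) / (B + 1) = i := by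
  rw [add_comm, Nat.add_mul_div_right _ _ (by omega), Nat.div_eq_of_lt (by omega), zero_add]

theorem block_inj {i j B r s : ℕ} (hr : r ≤ B) (hs : s ≤ B)
    (h : i * (B + 1) + r = j * (B + 1) + s) : i = j ∧ r = s := by
  have h1 : i = j := by rw [← block_div (i := i) hr, h, block_div hs]
  subst h1
  omega

theorem block_le_of_le {i j B r s : ℕ} (hs : s ≤ B)
    (h : i * (B + 1) + r ≤ j * (B + 1) + s) : i ≤ j := by
  by_contra! hij
  have : (j + 1) * (B + 1) ≤ i * (B + 1) := Nat.mul_le_mul_right _ hij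
  rw [add_one_mul] at this
  omega

theorem treePos_lt (k : ℕ) : ∀ d (v : TreeVertex k d), treePos k d v < treeCard k d
  | _ + 1, .inl i => block_lt i.2 le_rfl
  | d + 1, .inr (i, v) => block_lt i.2 (treePos_lt k d v).le

theorem treePos_injective (k : ℕ) : ∀ d, Function.Injective (treePos k d)
  | 0, v, _, _ => nomatch v
  | _ + 1, .inl i, .inl j, h => by
    rw [Fin.ext (block_inj le_rfl le_rfl h).1]
  | d + 1, .inl i, .inr (j, v), h => by
    have := (block_inj le_rfl (treePos_lt k d v).le h).2
    have := treePos_lt k d v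
    omega
  | d + 1, .inr (i, u), .inl j, h => by
    have := (block_inj (treePos_lt k d u).le le_rfl h).2
    have := treePos_lt k d u
    omega
  | d + 1, .inr (i, u), .inr (j, v), h => by
    have := block_inj (treePos_lt k d u).le (treePos_lt k d v).le h
    rw [Fin.ext this.1, treePos_injective k d this.2]

theorem exists_treePos_eq (k : ℕ) : ∀ d m, m < treeCard k d → ∃ v, treePos k d v = m
  | d + 1, m, h => by
    have hB : 0 < treeCard k d + 1 := by omega
    have h1 : m / (treeCard k d + 1) < k := (Nat.div_lt_iff_lt_mul hB).2 h
    have h2 := Nat.div_add_mod' m (treeCard k d + 1)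
    rcases (Nat.lt_succ_iff.1 (Nat.mod_lt m hB)).eq_or_lt with h3 | h3
    · exact ⟨pathVertex ⟨_, h1⟩, (congrArg _ h3.symm).trans h2⟩
    · obtain ⟨v, hv⟩ := exists_treePos_eq k d _ h3
      exact ⟨copyVertex ⟨_, h1⟩ v, (congrArg _ hv).trans h2⟩

/-- The depth-first numbering of the vertices of `H_{d,k}`. -/
noncomputable def treeEquiv (d k : ℕ) : TreeVertex k d ≃ Fin (treeCard k d) :=
  Equiv.ofBijective (fun v => ⟨treePos k d v, treePos_lt k d v⟩)
    ⟨fun _ _ h => treePos_injective k d (congrArg Fin.val h), fun m =>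
      (exists_treePos_eq k d m m.2).imp fun _ hv => Fin.ext hv⟩

theorem treeEquiv_val (d k : ℕ) (v : TreeVertex k d) :
    (treeEquiv d k v).val = treePos k d v := rfl

theorem treePos_of_isRoot {k : ℕ} : ∀ {d : ℕ} {v : TreeVertex k d}, TreeIsRoot k d v →
    treePos k d v + 1 = treeCard k d
  | _ + 1, .inl i, h => by
    have h : i.val + 1 = k := h
    rw [treePos, treeCard, add_assoc, ← add_one_mul, h]

theorem exists_isRoot {k : ℕ} (hk : 0 < k) (d : ℕ) : ∃ v, TreeIsRoot k (d + 1) v :=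
  ⟨.inl ⟨k - 1, by omega⟩, by change k - 1 + 1 = k; omega⟩

theorem TreeIsRoot.unique {k d : ℕ} {u v : TreeVertex k d} (hu : TreeIsRoot k d u)
    (hv : TreeIsRoot k d v) : u = v := by
  have h1 := treePos_of_isRoot hu
  have h2 := treePos_of_isRoot hv
  exact treePos_injective k d (by omega)

/-- The vertices beyond position `m` that have a neighbour before position `m`. -/
def farSet (k d m : ℕ) : Set (TreeVertex k d) :=
  {v | m < treePos k d v ∧ ∃ u, treePos k d u < m ∧ TreeAdj k d u v}

/-- A block is a copy followed by its path vertex, and distinct blocks are joined only through path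
vertices. An edge jumping over `m` therefore ends in the block of `m`, at its path vertex or inside
its copy. -/
theorem farSet_succ_subset (k d m : ℕ) : farSet k (d + 1) m ⊆
    {v | ∃ i : Fin k, i.val = m / (treeCard k d + 1) ∧
      (v = .inl i ∨ ∃ w ∈ farSet k d (m % (treeCard k d + 1)), v = .inr (i, w))} := by
  have hm := Nat.div_add_mod' m (treeCard k d + 1)
  have hr : m % (treeCard k d + 1) ≤ treeCard k d :=
    Nat.lt_succ_iff.1 (Nat.mod_lt m (by omega))
  set j := m / (treeCard k d + 1)
  set r := m % (treeCard k d + 1)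
  rintro (i | ⟨i, v⟩) ⟨hv, u | ⟨i', u⟩, hu, hadj⟩
  · refine ⟨i, ?_, .inl rfl⟩
    simp only [treePos] at hu hv
    have h1 : j ≤ i.val := block_le_of_le (r := r) (s := treeCard k d) le_rfl (by omega)
    have h2 : u.val < j := by
      by_contra! h
      have := Nat.mul_le_mul_right (treeCard k d + 1) h
      omega
    have h3 : u.val + 1 = i.val ∨ i.val + 1 = u.val := hadj
    omega
  · refine ⟨i, ?_, .inl rfl⟩
    simp only [treePos] at hu hv
    obtain ⟨rfl, -⟩ : i' = i ∧ _ := hadj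
    have h1 : j ≤ i'.val := block_le_of_le (r := r) (s := treeCard k d) le_rfl (by omega)
    have h2 : i'.val ≤ j := block_le_of_le (r := treePos k d u) (s := r) hr (by omega)
    omega
  · simp only [treePos] at hu hv
    obtain ⟨rfl, -⟩ : u = i ∧ _ := hadj
    have := treePos_lt k d v
    omega
  · simp only [treePos] at hu hv
    obtain ⟨rfl, h⟩ : i' = i ∧ _ := hadj
    have h1 : j ≤ i'.val := block_le_of_le (r := r) (treePos_lt k d v).le (by omega)
    have h2 : i'.val ≤ j := block_le_of_le (r := treePos k d u) (s := r) hr (by omega)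
    have h3 : i'.val = j := le_antisymm h2 h1
    rw [h3] at hu hv
    exact ⟨i', h3, .inr ⟨v, ⟨by omega, u, by omega, h⟩, rfl⟩⟩

instance finite_treeVertex (k d : ℕ) : Finite (TreeVertex k d) :=
  Finite.of_equiv _ (treeEquiv d k).symm

theorem ncard_farSet_succ_le (k d m : ℕ) :
    (farSet k (d + 1) m).ncard ≤ 1 + (farSet k d (m % (treeCard k d + 1))).ncard := by
  by_cases hj : m / (treeCard k d + 1) < k
  · have h : farSet k (d + 1) m ⊆ {pathVertex ⟨_, hj⟩} ∪
        copyVertex ⟨_, hj⟩ '' farSet k d (m % (treeCard k d + 1)) := by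
      intro v hv
      obtain ⟨i, hi, h⟩ := farSet_succ_subset k d m hv
      obtain rfl : i = ⟨_, hj⟩ := Fin.ext hi
      rcases h with rfl | ⟨w, hw, rfl⟩
      · exact .inl rfl
      · exact .inr ⟨w, hw, rfl⟩
    refine (Set.ncard_le_ncard h (Set.toFinite _)).trans ((Set.ncard_union_le _ _).trans ?_)
    rw [Set.ncard_singleton]
    exact Nat.add_le_add_left (Set.ncard_image_le (Set.toFinite _)) 1
  · have h : farSet k (d + 1) m = ∅ := by
      refine Set.eq_empty_of_forall_notMem fun v hv => ?_
      obtain ⟨i, hi, -⟩ := farSet_succ_subset k d m hv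
      exact hj (hi ▸ i.2)
    rw [h, Set.ncard_empty]
    exact Nat.zero_le _

/-- Each level of nesting adds at most one path vertex. The innermost path adds none: its next
vertex is at position `m` itself, which `farSet` excludes. -/
theorem ncard_farSet_le (k : ℕ) : ∀ d m, (farSet k d m).ncard ≤ d - 1
  | 0, m => by 
    rw [Set.eq_empty_of_forall_notMem (s := farSet k 0 m) fun v => nomatch v]
    exact (Set.ncard_empty _).le
  | 1, m => by
    have h : farSet k 1 m = ∅ := by
      refine Set.eq_empty_of_forall_notMem fun v hv => ?_
      obtain ⟨i, hi, rfl | ⟨w, -, -⟩⟩ := farSet_succ_subset k 0 m hv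
      · have h1 := hv.1
        simp only [treePos, treeCard, zero_add, Nat.div_one] at h1 hi
        omega
      · exact nomatch w
    rw [h, Set.ncard_empty]
  | d + 2, m => by
    have := ncard_farSet_le k (d + 1) (m % (treeCard k (d + 1) + 1))
    refine (ncard_farSet_succ_le k (d + 1) m).trans ?_
    omega

theorem treePos_le_of_mem_farSet {k d m : ℕ} {v : TreeVertex k (d + 1)}
    (hv : v ∈ farSet k (d + 1) m) : treePos k (d + 1) v ≤ m + treeCard k d := by
  have hm := Nat.div_add_mod' m (treeCard k d + 1)
  obtain ⟨i, hi, rfl | ⟨w, -, rfl⟩⟩ := farSet_succ_subset k d m hv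
  · rw [treePos, hi]
    omega
  · have := treePos_lt k d w
    rw [treePos, hi]
    omega

/-- The sharper bound at the root feeds the induction, since a root gains one edge when its tree
becomes a copy. -/
theorem ncard_neighborSet_tree_le (k : ℕ) : ∀ d (v : TreeVertex k d),
    ((iteratedPathTree d k).neighborSet v).ncard ≤ 3 ∧
      (TreeIsRoot k d v → ((iteratedPathTree d k).neighborSet v).ncard ≤ 2)
  | d + 1, .inl i => by
    let R : Set (TreeVertex k (d + 1)) := {v | ∃ w, TreeIsRoot k d w ∧ v = .inr (i, w)}
    let S : Set (TreeVertex k (d + 1)) := {v | ∃ j : Fin k, j.val + 1 = i.val ∧ v = .inl j}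
    let T : Set (TreeVertex k (d + 1)) := {v | ∃ j : Fin k, i.val + 1 = j.val ∧ v = .inl j}
    have hR : R.ncard ≤ 1 := (Set.ncard_le_one (Set.toFinite _)).2 fun a ha b hb => by
      obtain ⟨x, hx, rfl⟩ := ha
      obtain ⟨y, hy, rfl⟩ := hb
      rw [hx.unique hy]
    have hS : S.ncard ≤ 1 := (Set.ncard_le_one (Set.toFinite _)).2 fun a ha b hb => by
      obtain ⟨x, hx, rfl⟩ := ha
      obtain ⟨y, hy, rfl⟩ := hb
      rw [show x = y by omega]
    have hT : T.ncard ≤ 1 := (Set.ncard_le_one (Set.toFinite _)).2 fun a ha b hb => by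
      obtain ⟨x, hx, rfl⟩ := ha
      obtain ⟨y, hy, rfl⟩ := hb
      rw [show x = y by omega]
    have hsub : (iteratedPathTree (d + 1) k).neighborSet (.inl i) ⊆ (R ∪ S) ∪ T := by
      rintro (j | ⟨j, w⟩) h
      · rcases (show i.val + 1 = j.val ∨ j.val + 1 = i.val from h) with h | h
        · exact .inr ⟨j, h, rfl⟩
        · exact .inl (.inr ⟨j, h, rfl⟩)
      · obtain ⟨rfl, h⟩ : i = j ∧ _ := h
        exact .inl (.inl ⟨w, h, rfl⟩)
    have h1 := Set.ncard_le_ncard hsub (Set.toFinite _)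
    have h2 := Set.ncard_union_le (R ∪ S) T
    have h3 := Set.ncard_union_le R S
    refine ⟨by omega, fun hr => ?_⟩
    have : T = ∅ := Set.eq_empty_of_forall_notMem fun v ⟨j, hj, _⟩ => by
      have : i.val + 1 = k := hr
      omega
    rw [this, Set.ncard_empty] at h2
    rw [this] at h1
    omega
  | d + 1, .inr (i, u) => by
    refine ⟨?_, fun h => h.elim⟩
    obtain ⟨ih, ihr⟩ := ncard_neighborSet_tree_le k d u
    have himg := Set.ncard_image_le (f := copyVertex i)
      (Set.toFinite ((iteratedPathTree d k).neighborSet u))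
    by_cases hu : TreeIsRoot k d u
    · have hsub : (iteratedPathTree (d + 1) k).neighborSet (copyVertex i u) ⊆
          {pathVertex i} ∪ copyVertex i '' (iteratedPathTree d k).neighborSet u := by
        rintro (j | ⟨j, w⟩) h
        · obtain ⟨rfl, h⟩ : i = j ∧ _ := h
          exact .inl rfl
        · obtain ⟨rfl, h⟩ : i = j ∧ _ := h
          exact .inr ⟨w, h, rfl⟩
      have h1 := Set.ncard_le_ncard hsub (Set.toFinite _)
      have h2 := Set.ncard_union_le {pathVertex i}
        (copyVertex i '' (iteratedPathTree d k).neighborSet u)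
      rw [Set.ncard_singleton] at h2
      have := ihr hu
      change ((iteratedPathTree (d + 1) k).neighborSet (copyVertex i u)).ncard ≤ 3
      omega
    · have hsub : (iteratedPathTree (d + 1) k).neighborSet (copyVertex i u) ⊆
          copyVertex i '' (iteratedPathTree d k).neighborSet u := by
        rintro (j | ⟨j, w⟩) h
        · exact (hu (show i = j ∧ TreeIsRoot k d u from h).2).elim
        · obtain ⟨rfl, h⟩ : i = j ∧ _ := h
          exact ⟨w, h, rfl⟩
      have h1 := Set.ncard_le_ncard hsub (Set.toFinite _)
      change ((iteratedPathTree (d + 1) k).neighborSet (copyVertex i u)).ncard ≤ 3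
      omega

/-- The inclusion of a copy of `H_{d,k}` into `H_{d+1,k}`. -/
def treeCopyHom (d k : ℕ) (i : Fin k) : iteratedPathTree d k →g iteratedPathTree (d + 1) k where
  toFun := copyVertex i
  map_rel' h := ⟨rfl, h⟩

theorem exists_path_walk_to_root (d k : ℕ) {r : TreeVertex k (d + 1)}
    (hr : TreeIsRoot k (d + 1) r) (s : ℕ) : ∀ i : Fin k, i.val + s + 1 = k →
      ∃ p : (iteratedPathTree (d + 1) k).Walk (pathVertex i) r, p.length = s := by
  induction s with
  | zero =>
    intro i hi
    obtain rfl : r = .inl i := hr.unique hi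
    exact ⟨.nil, rfl⟩
  | succ s ih =>
    intro i hi
    obtain ⟨p, hp⟩ := ih ⟨i.val + 1, by omega⟩ (by dsimp only; omega)
    have h : (iteratedPathTree (d + 1) k).Adj (pathVertex i) (pathVertex ⟨i.val + 1, by omega⟩) :=
      Or.inl rfl
    exact ⟨.cons h p, by rw [SimpleGraph.Walk.length_cons, hp]⟩

theorem exists_walk_to_root {k : ℕ} (hk : 0 < k) : ∀ (d : ℕ) {r : TreeVertex k d}
    (_ : TreeIsRoot k d r) (v : TreeVertex k d),
    ∃ p : (iteratedPathTree d k).Walk v r, p.length ≤ d * k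
  | d + 1, r, hr, .inl i => by
    obtain ⟨p, hp⟩ := exists_path_walk_to_root d k hr (k - i.val - 1) i (by omega)
    have hle : p.length ≤ (d + 1) * k := by
      rw [hp, add_one_mul]
      omega
    exact ⟨p, hle⟩
  | 0 + 1, r, hr, .inr (i, v) => nomatch v
  | d + 1 + 1, r, hr, .inr (i, v) => by
    obtain ⟨s, hs⟩ := exists_isRoot hk d
    obtain ⟨p, hp⟩ := exists_walk_to_root hk (d + 1) hs v
    obtain ⟨q, hq⟩ := exists_path_walk_to_root (d + 1) k hr (k - i.val - 1) i (by omega)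
    have h : (iteratedPathTree (d + 1 + 1) k).Adj (treeCopyHom (d + 1) k i s) (pathVertex i) :=
      ⟨rfl, hs⟩
    let w : (iteratedPathTree (d + 1 + 1) k).Walk (treeCopyHom (d + 1) k i v) r :=
      (p.map (treeCopyHom (d + 1) k i)).append (.cons h q)
    have hw : w.length ≤ (d + 1 + 1) * k := by
      rw [SimpleGraph.Walk.length_append (p := p.map (treeCopyHom (d + 1) k i)),
        SimpleGraph.Walk.length_cons, SimpleGraph.Walk.length_map, hq, add_one_mul (d + 1)]
      omega
    exact ⟨w, hw⟩

theorem connected_iteratedPathTree {k : ℕ} (hk : 0 < k) (d : ℕ) :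
    (iteratedPathTree (d + 1) k).Connected := by
  obtain ⟨r, hr⟩ := exists_isRoot hk d
  have : Nonempty (TreeVertex k (d + 1)) := ⟨r⟩
  refine ⟨fun u v => ?_⟩
  obtain ⟨p, -⟩ := exists_walk_to_root hk (d + 1) hr u
  obtain ⟨q, -⟩ := exists_walk_to_root hk (d + 1) hr v
  exact p.reachable.trans q.reachable.symm

end Tree

/-! ### Bounds for the condition number of the Laplacian. -/

section Laplacian

open Matrix

open scoped Classical in
/-- The value of the Laplacian of `G` on a function `x`. -/
noncomputable def lapFun {V : Type*} [Fintype V] (G : SimpleGraph V) (x : V → ℝ) (v : V) : ℝ :=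
  ∑ u, if G.Adj v u then x v - x u else 0

/-- Applied at the largest entry of an eigenvector, this bounds the eigenvalue by `2Δ`. -/
theorem abs_lapFun_le {V : Type*} [Fintype V] (G : SimpleGraph V) {Δ : ℕ} {v : V}
    (hdeg : (G.neighborSet v).ncard ≤ Δ)
    {x : V → ℝ} (hv : ∀ u, |x u| ≤ |x v|) : |lapFun G x v| ≤ 2 * Δ * |x v| := by
  classical
  have h1 : ((Finset.univ.filter (G.Adj v)).card : ℝ) ≤ Δ := by
    rw [← Set.ncard_coe_finset]
    refine Nat.cast_le.2 (le_trans (le_of_eq ?_) hdeg)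
    congr 1
    ext u
    simp
  rw [lapFun, ← Finset.sum_filter]
  refine (Finset.abs_sum_le_sum_abs _ _).trans ?_
  have h2 : ∀ u ∈ Finset.univ.filter (G.Adj v), |x v - x u| ≤ 2 * |x v| := fun u _ => by
    have := abs_sub (x v) (x u)
    have := hv u
    linarith
  refine (Finset.sum_le_card_nsmul _ _ _ h2).trans ?_
  rw [nsmul_eq_mul]
  have := abs_nonneg (x v)
  nlinarith

/-- Cauchy–Schwarz for the telescoping sum of increments along the walk. -/
theorem sq_sub_le_length_mul_sum {V : Type*} {G : SimpleGraph V} (x : V → ℝ) {u v : V}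
    (p : G.Walk u v) :
    (x u - x v) ^ 2 ≤ p.length * (p.darts.map fun e => (x e.fst - x e.snd) ^ 2).sum := by
  induction p with
  | nil => simp
  | @cons u w v h p ih =>
    rw [SimpleGraph.Walk.length_cons, SimpleGraph.Walk.darts_cons, List.map_cons, List.sum_cons]
    push_cast
    set S := (p.darts.map fun e => (x e.fst - x e.snd) ^ 2).sum
    have hS : 0 ≤ S := List.sum_nonneg fun y hy => by
      obtain ⟨e, -, rfl⟩ := List.mem_map.1 hy
      positivity
    rcases Nat.eq_zero_or_pos p.length with h0 | h0
    · rw [h0] at ih ⊢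
      have : x w - x v = 0 := by
        have := sq_nonneg (x w - x v)
        refine pow_eq_zero_iff two_ne_zero |>.1 (le_antisymm ?_ this)
        simpa using ih
      have : x u - x v = x u - x w := by linarith
      rw [this]
      simp
      linarith
    · have hl : (0 : ℝ) < p.length := by exact_mod_cast h0
      set l : ℝ := (p.length : ℝ)
      have h1 := sq_nonneg (l * (x u - x w) - (x w - x v))
      have h2 : l * (x u - x v) ^ 2 ≤ l * ((l + 1) * ((x u - x w) ^ 2 + S)) := by
        nlinarith
      exact le_of_mul_le_mul_left h2 hl

section General

variable {V : Type*} [Fintype V] [DecidableEq V]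

theorem lapMatrix_mulVec_eq_lapFun (G : SimpleGraph V) [DecidableRel G.Adj] (x : V → ℝ) :
    G.lapMatrix ℝ *ᵥ x = lapFun G x := by
  funext v
  have h : G.neighborFinset v = Finset.univ.filter (G.Adj v) := by
    ext u
    simp
  rw [SimpleGraph.lapMatrix_mulVec_apply, ← SimpleGraph.card_neighborFinset_eq_degree,
    ← nsmul_eq_mul, ← Finset.sum_const, ← Finset.sum_sub_distrib, h, Finset.sum_filter]
  exact Finset.sum_congr rfl fun u _ => by split_ifs <;> rfl

theorem exists_mulVec_eq_smul_of_mem_spectrum {A : Matrix V V ℝ} {t : ℝ} (ht : t ∈ spectrum ℝ A) :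
    ∃ x : V → ℝ, x ≠ 0 ∧ A *ᵥ x = t • x := by
  rw [← Matrix.spectrum_toLin', ← Module.End.hasEigenvalue_iff_mem_spectrum] at ht
  obtain ⟨x, hx⟩ := ht.exists_hasEigenvector
  exact ⟨x, hx.2, by simpa using hx.apply_eq_smul⟩

/-- The weights are the squared coefficients of `x` in an orthonormal eigenbasis. They reduce form
inequalities to scalar ones on the spectrum. -/
theorem exists_weights_of_isHermitian {A : Matrix V V ℝ} (hA : A.IsHermitian) (x : V → ℝ) :
    ∃ w : V → ℝ, (∀ i, 0 ≤ w i) ∧ x ⬝ᵥ (A *ᵥ x) = ∑ i, hA.eigenvalues i * w i ∧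
      (A *ᵥ x) ⬝ᵥ (A *ᵥ x) = ∑ i, hA.eigenvalues i ^ 2 * w i := by
  let b : V → V → ℝ := fun i => (hA.eigenvectorBasis i).ofLp
  have hpars : ∀ u v : V → ℝ, u ⬝ᵥ v = ∑ i, (b i ⬝ᵥ u) * (b i ⬝ᵥ v) := by
    intro u v
    have h := hA.eigenvectorBasis.sum_inner_mul_inner (WithLp.toLp 2 u) (WithLp.toLp 2 v)
    simp only [EuclideanSpace.inner_eq_star_dotProduct, star_trivial] at h
    rw [dotProduct_comm u v, ← h]
    exact Finset.sum_congr rfl fun i _ => by rw [dotProduct_comm v]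
  have hb : ∀ i, b i ⬝ᵥ (A *ᵥ x) = hA.eigenvalues i * (b i ⬝ᵥ x) := by
    intro i
    have h1 : A *ᵥ b i = hA.eigenvalues i • b i := hA.mulVec_eigenvectorBasis i
    have h2 : Aᵀ = A := by rw [← conjTranspose_eq_transpose_of_trivial]; exact hA
    rw [dotProduct_mulVec, ← mulVec_transpose, h2, h1, smul_dotProduct, smul_eq_mul]
  refine ⟨fun i => (b i ⬝ᵥ x) ^ 2, fun i => sq_nonneg _, ?_, ?_⟩
  · rw [hpars]
    exact Finset.sum_congr rfl fun i _ => by rw [hb]; ring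
  · rw [hpars]
    exact Finset.sum_congr rfl fun i _ => by rw [hb]; ring

/-- The eigenvalue `0` satisfies the hypothesis trivially, so `s` may be the least positive
eigenvalue without projecting `x` off the kernel. -/
theorem mul_form_le_of_forall_spectrum {A : Matrix V V ℝ} (hA : A.IsHermitian) {s : ℝ}
    (hs : ∀ t ∈ spectrum ℝ A, s * t ≤ t ^ 2) (x : V → ℝ) :
    s * (x ⬝ᵥ (A *ᵥ x)) ≤ (A *ᵥ x) ⬝ᵥ (A *ᵥ x) := by
  obtain ⟨w, hw, h1, h2⟩ := exists_weights_of_isHermitian hA x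
  rw [h1, h2, Finset.mul_sum]
  refine Finset.sum_le_sum fun i _ => ?_
  rw [← mul_assoc]
  exact mul_le_mul_of_nonneg_right (hs _ (hA.eigenvalues_mem_spectrum_real i)) (hw i)

theorem form_le_mul_of_forall_spectrum {A : Matrix V V ℝ} (hA : A.IsHermitian) {s : ℝ}
    (hs : ∀ t ∈ spectrum ℝ A, t ^ 2 ≤ s * t) (x : V → ℝ) :
    (A *ᵥ x) ⬝ᵥ (A *ᵥ x) ≤ s * (x ⬝ᵥ (A *ᵥ x)) := by
  obtain ⟨w, hw, h1, h2⟩ := exists_weights_of_isHermitian hA x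
  rw [h1, h2, Finset.mul_sum]
  refine Finset.sum_le_sum fun i _ => ?_
  rw [← mul_assoc]
  exact mul_le_mul_of_nonneg_right (hs _ (hA.eigenvalues_mem_spectrum_real i)) (hw i)

theorem sum_darts_le (G : SimpleGraph V) [DecidableRel G.Adj] (x : V → ℝ) {u v : V}
    {p : G.Walk u v} (hp : p.IsPath) :
    (p.darts.map fun e => (x e.fst - x e.snd) ^ 2).sum ≤ 2 * (x ⬝ᵥ (G.lapMatrix ℝ *ᵥ x)) := by
  have hform : 2 * (x ⬝ᵥ (G.lapMatrix ℝ *ᵥ x)) =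
      ∑ e : V × V, if G.Adj e.1 e.2 then (x e.1 - x e.2) ^ 2 else 0 := by
    rw [← Matrix.toLinearMap₂'_apply', SimpleGraph.lapMatrix_toLinearMap₂', Fintype.sum_prod_type]
    ring
  have hnd := SimpleGraph.Walk.darts_nodup_of_support_nodup hp.support_nodup
  rw [hform, ← List.sum_toFinset _ hnd, ← Finset.sum_filter]
  have hinj : Function.Injective fun e : G.Dart => e.toProd :=
    SimpleGraph.Dart.toProd_injective
  refine (Finset.sum_map p.darts.toFinset ⟨_, hinj⟩
    fun e : V × V => (x e.1 - x e.2) ^ 2).symm.le.trans ?_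
  refine Finset.sum_le_sum_of_subset_of_nonneg ?_ fun _ _ _ => sq_nonneg _
  intro e he
  obtain ⟨a, -, rfl⟩ := Finset.mem_map.1 he
  simp

/-- A Poincaré inequality: differences to `r` are controlled along paths, and the zero mean makes `∑
(x v - x r)²` at least `∑ (x v)²`. -/
theorem sum_sq_le_mul_form (G : SimpleGraph V) [DecidableRel G.Adj] {l : ℕ} {r : V}
    (hw : ∀ v, ∃ p : G.Walk v r, p.length ≤ l) {x : V → ℝ} (hx : ∑ v, x v = 0) :
    x ⬝ᵥ x ≤ 2 * Fintype.card V * l * (x ⬝ᵥ (G.lapMatrix ℝ *ᵥ x)) := by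
  set E := x ⬝ᵥ (G.lapMatrix ℝ *ᵥ x)
  have hE : 0 ≤ E := by
    simpa using (SimpleGraph.posSemidef_lapMatrix ℝ G).dotProduct_mulVec_nonneg x
  have h1 : ∀ v, (x v - x r) ^ 2 ≤ l * (2 * E) := fun v => by
    obtain ⟨p, hp⟩ := hw v
    refine (sq_sub_le_length_mul_sum x (p.toPath : G.Walk v r)).trans ?_
    have h2 := sum_darts_le G x p.toPath.2
    have h3 : ((p.toPath : G.Walk v r).length : ℝ) ≤ l :=
      Nat.cast_le.2 ((p.length_bypass_le_length).trans hp)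
    exact (mul_le_mul_of_nonneg_left h2 (Nat.cast_nonneg _)).trans
      (mul_le_mul_of_nonneg_right h3 (by positivity))
  have h4 : ∑ v, (x v - x r) ^ 2 = x ⬝ᵥ x + Fintype.card V * x r ^ 2 := by
    have : ∀ v, (x v - x r) ^ 2 = x v * x v - 2 * x r * x v + x r ^ 2 := fun v => by ring
    simp_rw [this, Finset.sum_add_distrib, Finset.sum_sub_distrib, ← Finset.mul_sum, hx]
    simp [dotProduct]
  have h5 := Finset.sum_le_card_nsmul Finset.univ _ _ fun v _ => h1 v
  rw [h4, nsmul_eq_mul, Finset.card_univ] at h5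
  have h6 : 0 ≤ (Fintype.card V : ℝ) * x r ^ 2 := by positivity
  nlinarith

end General

theorem lapFun_comp_iso {V W : Type*} [Fintype V] [Fintype W] {G : SimpleGraph V}
    {H : SimpleGraph W} (e : G ≃g H) (x : W → ℝ) (v : V) :
    lapFun G (x ∘ e) v = lapFun H x (e v) := by
  classical
  rw [lapFun, lapFun, ← Equiv.sum_comp e.toEquiv]
  refine Finset.sum_congr rfl fun u _ => ?_
  change _ = if H.Adj (e v) (e u) then x (e v) - x (e u) else 0
  by_cases h : G.Adj v u
  · rw [if_pos h, if_pos (e.map_adj_iff.2 h)]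
    rfl
  · rw [if_neg h, if_neg (mt e.map_adj_iff.1 h)]

/-- The largest eigenvalue is at most `2Δ`, and the Poincaré inequality bounds every positive one
below by `1 / (2nl)`. -/
theorem graphCondition_le {n : ℕ} (G : SimpleGraph (Fin n)) {Δ l : ℕ}
    (hdeg : ∀ v, (G.neighborSet v).ncard ≤ Δ) {r : Fin n}
    (hw : ∀ v, ∃ p : G.Walk v r, p.length ≤ l) :
    graphCondition G ≤ 4 * Δ * n * l := by
  classical
  have hmax : sSup (laplacianSpectrum G) ≤ 2 * Δ := by
    refine Real.sSup_le (fun t ht => ?_) (by positivity)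
    obtain ⟨x, hx0, hx⟩ := exists_mulVec_eq_smul_of_mem_spectrum ht
    have : Nonempty (Fin n) := ⟨r⟩
    obtain ⟨v, hv⟩ := Finite.exists_max fun u => |x u|
    have h1 := abs_lapFun_le G (hdeg v) hv
    rw [← lapMatrix_mulVec_eq_lapFun, hx, Pi.smul_apply, smul_eq_mul, abs_mul] at h1
    have h2 : 0 < |x v| := by
      obtain ⟨u, hu⟩ := Function.ne_iff.1 hx0
      exact (abs_pos.2 hu).trans_le (hv u)
    exact (le_abs_self t).trans (le_of_mul_le_mul_right h1 h2)
  set S : Set ℝ := {t | t ∈ laplacianSpectrum G ∧ 0 < t}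
  rcases S.eq_empty_or_nonempty with hS | hS
  -- Without positive eigenvalues the quotient is a division by `sInf ∅ = 0`, hence `0`.
  · rw [graphCondition, show {t | t ∈ laplacianSpectrum G ∧ 0 < t} = ∅ from hS, Real.sInf_empty,
      div_zero]
    positivity
  have hmin : ∀ t ∈ S, 1 ≤ 2 * n * l * t := by
    rintro t ⟨ht, ht0⟩
    obtain ⟨x, hx0, hx⟩ := exists_mulVec_eq_smul_of_mem_spectrum ht
    have hsum : ∑ v, x v = 0 := by
      have h1 : (fun _ => 1) ⬝ᵥ (G.lapMatrix ℝ *ᵥ x) = 0 := by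
        rw [dotProduct_mulVec, ← mulVec_transpose, SimpleGraph.isSymm_lapMatrix,
          SimpleGraph.lapMatrix_mulVec_const_eq_zero, zero_dotProduct]
      rw [hx, dotProduct_smul, smul_eq_mul, mul_eq_zero] at h1
      simpa [dotProduct] using h1.resolve_left ht0.ne'
    have h2 := sum_sq_le_mul_form G hw hsum
    rw [hx, dotProduct_smul, smul_eq_mul, Fintype.card_fin] at h2
    have h3 : 0 < x ⬝ᵥ x := (dotProduct_self_star_pos_iff (v := x)).2 hx0
    by_contra! h
    have := mul_lt_mul_of_pos_right h h3
    linarith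
  have hnl : 0 < 2 * (n : ℝ) * l := by
    obtain ⟨t, ht⟩ := hS
    by_contra! h
    have := hmin t ht
    have := mul_nonneg (sub_nonneg.2 h) ht.2.le
    linarith
  have hinf : 1 / (2 * n * l) ≤ sInf S := le_csInf hS fun t ht => by
    rw [div_le_iff₀ hnl, mul_comm]
    exact hmin t ht
  have hpos : 0 < sInf S := (by positivity : (0 : ℝ) < 1 / (2 * n * l)).trans_le hinf
  rw [graphCondition, div_le_iff₀ hpos]
  refine hmax.trans ?_
  rw [div_le_iff₀ hnl] at hinf
  have h5 : (0 : ℝ) ≤ 2 * Δ := by positivity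
  have := mul_le_mul_of_nonneg_left hinf h5
  linarith

/-- A test vector gives `λ_min⁺ E ≤ C`, while `λ_max ≥ 1` as soon as there is an edge. -/
theorem le_mul_graphCondition {n : ℕ} (G : SimpleGraph (Fin n)) {u v : Fin n} (huv : G.Adj u v)
    {x : Fin n → ℝ} {C E : ℝ} (hE : 0 < E) (h1 : E ≤ ∑ v, x v * lapFun G x v)
    (h2 : ∑ v, lapFun G x v ^ 2 ≤ C) : E ≤ C * graphCondition G := by
  classical
  set A := G.lapMatrix ℝ with hAdef
  have hA : A.IsHermitian := SimpleGraph.isHermitian_lapMatrix ℝ G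
  have hfin : (laplacianSpectrum G).Finite := Matrix.finite_real_spectrum
  have hne : (laplacianSpectrum G).Nonempty := ⟨_, hA.eigenvalues_mem_spectrum_real u⟩
  have hnn : ∀ t ∈ laplacianSpectrum G, 0 ≤ t := by
    intro t ht
    rw [laplacianSpectrum, hA.spectrum_real_eq_range_eigenvalues] at ht
    obtain ⟨i, rfl⟩ := ht
    exact (SimpleGraph.posSemidef_lapMatrix ℝ G).eigenvalues_nonneg i
  have hmax : 1 ≤ sSup (laplacianSpectrum G) := by
    have h := form_le_mul_of_forall_spectrum hA (s := sSup (laplacianSpectrum G))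
      (fun t ht => by
        rw [sq]
        exact mul_le_mul_of_nonneg_right (le_csSup hfin.bddAbove ht) (hnn t ht)) (Pi.single u 1)
    have hdiag : A u u = G.degree u := by
      simp [hAdef, SimpleGraph.lapMatrix, SimpleGraph.degMatrix]
    have hd : (1 : ℝ) ≤ G.degree u :=
      Nat.one_le_cast.2 ((G.degree_pos_iff_exists_adj u).2 ⟨v, huv⟩)
    rw [mulVec_single_one, single_one_dotProduct, col_apply, hdiag] at h
    have h3 : (G.degree u : ℝ) * G.degree u ≤ A.col u ⬝ᵥ A.col u := by
      rw [← hdiag]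
      exact Finset.single_le_sum (f := fun w => A.col u w * A.col u w)
        (fun w _ => mul_self_nonneg _) (Finset.mem_univ u)
    have := le_of_mul_le_mul_right (h3.trans h) (by linarith)
    linarith
  set S : Set ℝ := {t | t ∈ laplacianSpectrum G ∧ 0 < t}
  have hSne : S.Nonempty := ⟨_, hne.csSup_mem hfin, by linarith⟩
  have hSmem : sInf S ∈ S := hSne.csInf_mem (hfin.subset fun t ht => ht.1)
  have hmin := mul_form_le_of_forall_spectrum hA (s := sInf S) (fun t ht => by
    rcases (hnn t ht).eq_or_lt with h | h
    · simp [← h]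
    · rw [sq]
      exact mul_le_mul_of_nonneg_right (csInf_le ⟨0, fun t ht => ht.2.le⟩ ⟨ht, h⟩) h.le) x
  rw [hAdef, lapMatrix_mulVec_eq_lapFun] at hmin
  simp only [dotProduct, ← sq] at hmin
  have hpos : 0 < sInf S := hSmem.2
  have h4 : sInf S * E ≤ C := (mul_le_mul_of_nonneg_left h1 hpos.le).trans (hmin.trans h2)
  have hC : 0 ≤ C := (by positivity : 0 ≤ sInf S * E).trans h4
  have h5 : 1 / sInf S ≤ graphCondition G := div_le_div_of_nonneg_right hmax hpos.le
  calc E ≤ C / sInf S := by rwa [le_div_iff₀ hpos, mul_comm]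
    _ = C * (1 / sInf S) := by ring
    _ ≤ _ := mul_le_mul_of_nonneg_left h5 hC

end Laplacian

/-! ### A test function that is harmonic except at the two ends of the outer path. -/

section TreeHeight

/-- The index of the outer path vertex below which a vertex of `H_{d+1,k}` hangs. -/
def treeHeight {k d : ℕ} : TreeVertex k (d + 1) → ℝ
  | .inl i => i.val
  | .inr (i, _) => i.val

theorem treeHeight_pathVertex {k d : ℕ} (i : Fin k) :
    treeHeight (pathVertex i : TreeVertex k (d + 1)) = i.val := rfl

theorem treeVertex_cases {k d : ℕ} (v : TreeVertex k (d + 1)) :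
    (∃ i, v = pathVertex i) ∨ ∃ i w, v = copyVertex i w := by
  rcases v with i | ⟨i, w⟩
  · exact .inl ⟨i, rfl⟩
  · exact .inr ⟨i, w, rfl⟩

theorem pathVertex_injective {k d : ℕ} :
    Function.Injective (pathVertex : Fin k → TreeVertex k (d + 1)) := Sum.inl_injective

theorem treeHeight_eq_of_adj {k d : ℕ} {u v : TreeVertex k (d + 1)}
    (h : (iteratedPathTree (d + 1) k).Adj u v) (hne : treeHeight u ≠ treeHeight v) :
    ∃ i j : Fin k, u = pathVertex i ∧ v = pathVertex j ∧
      (i.val + 1 = j.val ∨ j.val + 1 = i.val) := by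
  rcases u with i | ⟨i, u⟩ <;> rcases v with j | ⟨j, v⟩
  · exact ⟨i, j, rfl, rfl, h⟩
  all_goals
    obtain ⟨rfl, -⟩ : i = j ∧ _ := h
    exact (hne rfl).elim

theorem adj_pathVertex {k d : ℕ} {i j : Fin k} (h : i.val + 1 = j.val ∨ j.val + 1 = i.val) :
    (iteratedPathTree (d + 1) k).Adj (pathVertex i) (pathVertex j) := h

variable {k d : ℕ} [Fintype (TreeVertex k (d + 1))]

theorem lapFun_treeHeight_copyVertex (i : Fin k) (w : TreeVertex k d) :
    lapFun (iteratedPathTree (d + 1) k) treeHeight (copyVertex i w) = 0 := by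
  refine Finset.sum_eq_zero fun u _ => ?_
  split_ifs with h
  · by_contra hne
    obtain ⟨a, b, h1, -⟩ := treeHeight_eq_of_adj h fun h => hne (sub_eq_zero.2 h)
    exact nomatch h1
  · rfl

theorem lapFun_treeHeight_interior {i : ℕ} (hi : i + 2 < k) :
    lapFun (iteratedPathTree (d + 1) k) treeHeight (pathVertex ⟨i + 1, by omega⟩) = 0 := by
  rw [lapFun, Fintype.sum_eq_add (pathVertex ⟨i, by omega⟩) (pathVertex ⟨i + 2, by omega⟩)]
  · rw [if_pos (adj_pathVertex (.inr rfl)), if_pos (adj_pathVertex (.inl rfl))]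
    simp only [treeHeight_pathVertex]
    push_cast
    ring
  · intro h
    have := congrArg Fin.val (pathVertex_injective h)
    simp at this
  · rintro u ⟨hu1, hu2⟩
    split_ifs with h
    · by_contra hne
      obtain ⟨a, b, h1, rfl, h2⟩ := treeHeight_eq_of_adj h fun h => hne (sub_eq_zero.2 h)
      obtain rfl := pathVertex_injective h1
      rcases h2 with h2 | h2
      · exact hu2 (congrArg _ (Fin.ext h2.symm))
      · exact hu1 (congrArg _ (Fin.ext (Nat.succ.inj h2)))
    · rfl

theorem lapFun_treeHeight_first (hk : 2 ≤ k) :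
    lapFun (iteratedPathTree (d + 1) k) treeHeight (pathVertex ⟨0, by omega⟩) = -1 := by
  rw [lapFun, Fintype.sum_eq_single (pathVertex ⟨1, by omega⟩)]
  · rw [if_pos (adj_pathVertex (.inl rfl))]
    simp [treeHeight_pathVertex]
  · intro u hu
    split_ifs with h
    · by_contra hne
      obtain ⟨a, b, h1, rfl, h2⟩ := treeHeight_eq_of_adj h fun h => hne (sub_eq_zero.2 h)
      obtain rfl := pathVertex_injective h1
      rcases h2 with h2 | h2
      · exact hu (congrArg _ (Fin.ext h2.symm))
      · exact absurd h2 (Nat.succ_ne_zero _)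
    · rfl

theorem lapFun_treeHeight_last {i : ℕ} (hi : i + 2 = k) :
    lapFun (iteratedPathTree (d + 1) k) treeHeight (pathVertex ⟨i + 1, by omega⟩) = 1 := by
  rw [lapFun, Fintype.sum_eq_single (pathVertex ⟨i, by omega⟩)]
  · rw [if_pos (adj_pathVertex (.inr rfl))]
    simp [treeHeight_pathVertex]
  · intro u hu
    split_ifs with h
    · by_contra hne
      obtain ⟨a, b, h1, rfl, h2⟩ := treeHeight_eq_of_adj h fun h => hne (sub_eq_zero.2 h)
      obtain rfl := pathVertex_injective h1
      rcases h2 with h2 | h2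
      · have := b.2
        dsimp only at h2
        omega
      · exact hu (congrArg _ (Fin.ext (Nat.succ.inj h2)))
    · rfl

theorem lapFun_treeHeight_eq_zero (hk : 2 ≤ k) {v : TreeVertex k (d + 1)}
    (h0 : v ≠ pathVertex ⟨0, by omega⟩) (h1 : v ≠ pathVertex ⟨k - 1, by omega⟩) :
    lapFun (iteratedPathTree (d + 1) k) treeHeight v = 0 := by
  rcases treeVertex_cases v with ⟨⟨i, hi⟩, rfl⟩ | ⟨i, w, rfl⟩
  · rcases i with _ | i
    · exact (h0 rfl).elim
    · have : i + 2 ≠ k := by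
        rintro rfl
        exact h1 rfl
      exact lapFun_treeHeight_interior (by omega)
  · exact lapFun_treeHeight_copyVertex i w

theorem lapFun_treeHeight_end (hk : 2 ≤ k) :
    lapFun (iteratedPathTree (d + 1) k) treeHeight (pathVertex ⟨k - 1, by omega⟩) = 1 := by
  obtain ⟨i, rfl⟩ := Nat.exists_eq_add_of_le' hk
  exact lapFun_treeHeight_last rfl

theorem sum_lapFun_treeHeight_sq (hk : 2 ≤ k) :
    ∑ v, lapFun (iteratedPathTree (d + 1) k) treeHeight v ^ 2 = 2 := by
  rw [Fintype.sum_eq_add (pathVertex ⟨0, by omega⟩) (pathVertex ⟨k - 1, by omega⟩),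
    lapFun_treeHeight_first hk, lapFun_treeHeight_end hk]
  · norm_num
  · intro h
    have := congrArg Fin.val (pathVertex_injective h)
    dsimp only at this
    omega
  · rintro v ⟨h0, h1⟩
    rw [lapFun_treeHeight_eq_zero hk h0 h1]
    norm_num

theorem sum_treeHeight_mul_lapFun (hk : 2 ≤ k) :
    ∑ v, treeHeight v * lapFun (iteratedPathTree (d + 1) k) treeHeight v = k - 1 := by
  rw [Fintype.sum_eq_single (pathVertex ⟨k - 1, by omega⟩), lapFun_treeHeight_end hk,
    treeHeight_pathVertex, mul_one]
  · dsimp only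
    rw [Nat.cast_sub (by omega), Nat.cast_one]
  · intro v h1
    by_cases h0 : v = pathVertex ⟨0, by omega⟩
    · rw [h0, treeHeight_pathVertex]
      simp
    · rw [lapFun_treeHeight_eq_zero hk h0 h1, mul_zero]

end TreeHeight

theorem le_two_mul_graphCondition {n k d : ℕ} {G : SimpleGraph (Fin n)} (hk : 2 ≤ k)
    (e : G ≃g iteratedPathTree (d + 1) k) : (k : ℝ) - 1 ≤ 2 * graphCondition G := by
  have : Fintype (TreeVertex k (d + 1)) := Fintype.ofFinite _
  have h2 : (2 : ℝ) ≤ k := by exact_mod_cast hk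
  have hadj : (iteratedPathTree (d + 1) k).Adj (pathVertex ⟨0, by omega⟩)
      (pathVertex ⟨1, by omega⟩) := Or.inl rfl
  refine le_mul_graphCondition G (e.symm.map_adj_iff.2 hadj) (x := treeHeight ∘ e) (by linarith)
    ?_ ?_
  · simp_rw [lapFun_comp_iso e]
    rw [← sum_treeHeight_mul_lapFun hk (d := d)]
    exact (Equiv.sum_comp e.toEquiv fun v =>
      treeHeight v * lapFun (iteratedPathTree (d + 1) k) treeHeight v).symm.le
  · simp_rw [lapFun_comp_iso e]
    rw [← sum_lapFun_treeHeight_sq hk (d := d)]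
    exact (Equiv.sum_comp e.toEquiv fun v =>
      lapFun (iteratedPathTree (d + 1) k) treeHeight v ^ 2).le

theorem ncard_neighborSet_le_of_iso {V W : Type*} {G : SimpleGraph V} {H : SimpleGraph W}
    (e : G ≃g H) {Δ : ℕ} (h : ∀ w, (H.neighborSet w).ncard ≤ Δ) (v : V) :
    (G.neighborSet v).ncard ≤ Δ := by
  rw [← Nat.card_coe_set_eq, Nat.card_congr (e.mapNeighborSet v), Nat.card_coe_set_eq]
  exact h _

theorem graphCondition_le_of_iso {n k d : ℕ} {G : SimpleGraph (Fin n)} (hk : 0 < k)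
    (e : G ≃g iteratedPathTree (d + 1) k) :
    graphCondition G ≤ 12 * (d + 1) * n * k := by
  obtain ⟨r, hr⟩ := exists_isRoot hk d
  have h := graphCondition_le G (Δ := 3) (l := (d + 1) * k)
    (ncard_neighborSet_le_of_iso e fun v => (ncard_neighborSet_tree_le k (d + 1) v).1)
    (r := e.symm r) fun v => by
      obtain ⟨p, hp⟩ := exists_walk_to_root hk (d + 1) hr (e v)
      refine ⟨(p.map e.symm.toHom).copy (e.symm_apply_apply v) rfl, ?_⟩
      rw [SimpleGraph.Walk.length_copy, SimpleGraph.Walk.length_map]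
      exact hp
  refine h.trans (le_of_eq ?_)
  push_cast
  ring

/-! ### Relabelling the nodes so that information spreads slowly. -/

theorem exists_perm_mapsTo {α : Type*} [Fintype α] [DecidableEq α] {F W : Finset α}
    (h : F.card ≤ W.card) :
    ∃ σ : Equiv.Perm α, (∀ x ∈ F, σ x ∈ W) ∧ ∀ x, σ x ≠ x → x ∈ F ∪ W := by
  obtain ⟨W', hW', hc⟩ := Finset.exists_subset_card_eq h
  let e : {x : {x // x ∈ F ∪ W} // x.1 ∈ F} ≃ {x : {x // x ∈ F ∪ W} // x.1 ∈ W'} :=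
    ((Equiv.subtypeSubtypeEquivSubtype fun {_} hx => Finset.mem_union_left W hx).trans
      (Finset.equivOfCardEq hc.symm)).trans
      (Equiv.subtypeSubtypeEquivSubtype fun {_} hx => Finset.mem_union_right F (hW' hx)).symm
  refine ⟨Equiv.Perm.ofSubtype e.extendSubtype, fun x hx => ?_, fun x hx => ?_⟩
  · rw [Equiv.Perm.ofSubtype_apply_of_mem _ (Finset.mem_union_left W hx)]
    exact hW' (e.extendSubtype_mem ⟨x, Finset.mem_union_left W hx⟩ hx)
  · by_contra hn
    exact hx (Equiv.Perm.ofSubtype_apply_of_not_mem _ hn)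

/-- The tree `H_{d,k}` on the positions of its vertices. -/
noncomputable def posGraph (d k : ℕ) : SimpleGraph (Fin (treeCard k d)) :=
  (iteratedPathTree d k).comap (treeEquiv d k).symm

/-- The far vertices are sent into the `d` positions following `m`, whose occupants are permuted
within the union of the two sets. Position `m` lies in neither set and stays fixed. -/
theorem exists_shift (d k m : ℕ) (hm : m + d + 1 ≤ treeCard k (d + 1)) :
    ∃ σ : Equiv.Perm (Fin (treeCard k (d + 1))),
      (∀ p, σ p ≠ p → m < p.val ∧ p.val ≤ m + treeCard k d + d) ∧
      {p | σ p ≠ p}.ncard ≤ 2 * d ∧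
      ∀ p q, (posGraph (d + 1) k).Adj p q → p.val < m → m ≤ q.val → (σ q).val < m + d + 1 := by
  classical
  set n := treeCard k (d + 1)
  set e := treeEquiv (d + 1) k
  have : Fintype (TreeVertex k (d + 1)) := Fintype.ofFinite _
  let F : Finset (Fin n) := (farSet k (d + 1) m).toFinset.image e
  let W : Finset (Fin n) := Finset.univ.filter fun p => m < p.val ∧ p.val < m + d + 1
  have hF : F.card ≤ d := by
    refine Finset.card_image_le.trans ?_
    rw [← Set.ncard_eq_toFinset_card']
    exact ncard_farSet_le k (d + 1) m
  have hW : W.card = d := by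
    have : W.map Fin.valEmbedding = Finset.Ioo m (m + d + 1) := by
      ext p
      simp only [W, Finset.mem_map, Finset.mem_filter, Finset.mem_univ, true_and,
        Fin.valEmbedding_apply, Finset.mem_Ioo]
      exact ⟨fun ⟨q, hq, h⟩ => h ▸ hq, fun h => ⟨⟨p, by omega⟩, h, rfl⟩⟩
    rw [← Finset.card_map Fin.valEmbedding, this, Nat.card_Ioo]
    omega
  obtain ⟨σ, h1, h2⟩ := exists_perm_mapsTo (hF.trans hW.ge)
  refine ⟨σ, fun p hp => ?_, ?_, fun p q hpq hp hq => ?_⟩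
  · rcases Finset.mem_union.1 (h2 p hp) with h | h
    · obtain ⟨v, hv, rfl⟩ := Finset.mem_image.1 h
      rw [Set.mem_toFinset] at hv
      have h3 := treePos_le_of_mem_farSet hv
      have h4 := hv.1
      rw [← treeEquiv_val] at h3 h4
      change (e v).val ≤ _ at h3
      exact ⟨h4, by omega⟩
    · have := (Finset.mem_filter.1 h).2
      omega
  · have h3 : {p | σ p ≠ p} ⊆ ↑(F ∪ W) := fun p hp => h2 p hp
    refine (Set.ncard_le_ncard h3 (Set.toFinite _)).trans ?_
    rw [Set.ncard_coe_finset]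
    refine (Finset.card_union_le _ _).trans ?_
    omega
  · rcases hq.eq_or_lt with hq | hq
    · have : σ q = q := by
        by_contra h
        rcases Finset.mem_union.1 (h2 q h) with h | h
        · obtain ⟨v, hv, rfl⟩ := Finset.mem_image.1 h
          rw [Set.mem_toFinset] at hv
          have h4 := hv.1
          rw [← treeEquiv_val] at h4
          exact absurd hq h4.ne
        · have := (Finset.mem_filter.1 h).2
          omega
      rw [this]
      omega
    · have hqF : q ∈ F := by
        refine Finset.mem_image.2 ⟨e.symm q, ?_, e.apply_symm_apply q⟩
        rw [Set.mem_toFinset]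
        refine ⟨?_, e.symm p, ?_, hpq⟩
        · rw [← treeEquiv_val]
          exact hq.trans_eq (congrArg Fin.val (e.apply_symm_apply q)).symm
        · rw [← treeEquiv_val]
          exact (congrArg Fin.val (e.apply_symm_apply p)).trans_lt hp
      exact (Finset.mem_filter.1 (h1 q hqF)).2.2

/-- Every lost edge has an endpoint in `X`. -/
theorem ncard_edgeSet_diff_le {V : Type*} [Finite V] {G G' : SimpleGraph V} {Δ : ℕ}
    (hdeg : ∀ v, (G.neighborSet v).ncard ≤ Δ) {X : Set V}
    (hX : ∀ u v, u ∉ X → v ∉ X → G.Adj u v → G'.Adj u v) :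
    (G.edgeSet \ G'.edgeSet).ncard ≤ X.ncard * Δ := by
  classical
  have : Fintype V := Fintype.ofFinite V
  have h : G.edgeSet \ G'.edgeSet ⊆ ↑(X.toFinset.biUnion fun x => G.incidenceFinset x) := by
    intro e
    induction e with | _ u v
    rintro ⟨h1, h2⟩
    rw [SimpleGraph.mem_edgeSet] at h1 h2
    simp only [Finset.coe_biUnion, Set.mem_iUnion, SimpleGraph.coe_incidenceFinset,
      Set.mem_toFinset, Finset.mem_coe]
    by_cases hu : u ∈ X
    · exact ⟨u, hu, G.mk'_mem_incidenceSet_left_iff.2 h1⟩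
    · by_cases hv : v ∈ X
      · exact ⟨v, hv, G.mk'_mem_incidenceSet_right_iff.2 h1⟩
      · exact (h2 (hX u v hu hv h1)).elim
  refine (Set.ncard_le_ncard h (Set.toFinite _)).trans ?_
  rw [Set.ncard_coe_finset, Set.ncard_eq_toFinset_card']
  refine Finset.card_biUnion_le_card_mul _ _ _ fun v _ => ?_
  rw [SimpleGraph.card_incidenceFinset_eq_degree, ← SimpleGraph.card_neighborSet_eq_degree,
    ← Nat.card_eq_fintype_card, Nat.card_coe_set_eq]
  exact hdeg v

theorem ncard_symmDiff_edgeSet_comap_le {n Δ s : ℕ} {Q : SimpleGraph (Fin n)}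
    (hdeg : ∀ v, (Q.neighborSet v).ncard ≤ Δ) (π σ : Equiv.Perm (Fin n))
    (hσ : {p | σ p ≠ p}.ncard ≤ s) :
    (symmDiff (Q.comap π).edgeSet (Q.comap (σ * π)).edgeSet).ncard ≤ 2 * (s * Δ) := by
  set X : Set (Fin n) := π ⁻¹' {p | σ p ≠ p}
  have hX : X.ncard ≤ s :=
    (Set.ncard_preimage_of_injective_subset_range π.injective (by simp)).trans_le hσ
  have hfix : ∀ u, u ∉ X → σ (π u) = π u := fun u hu => not_not.1 hu
  have hadj : ∀ u v, u ∉ X → v ∉ X → ((Q.comap π).Adj u v ↔ (Q.comap (σ * π)).Adj u v) := by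
    intro u v hu hv
    simp [SimpleGraph.comap_adj, hfix u hu, hfix v hv]
  have h1 : ((Q.comap π).edgeSet \ (Q.comap (σ * π)).edgeSet).ncard ≤ X.ncard * Δ :=
    ncard_edgeSet_diff_le (ncard_neighborSet_le_of_iso (SimpleGraph.Iso.comap π Q) hdeg)
      fun u v hu hv => (hadj u v hu hv).1
  have h2 : ((Q.comap (σ * π)).edgeSet \ (Q.comap π).edgeSet).ncard ≤ X.ncard * Δ :=
    ncard_edgeSet_diff_le (ncard_neighborSet_le_of_iso (SimpleGraph.Iso.comap (σ * π) Q) hdeg)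
      fun u v hu hv => (hadj u v hu hv).2
  have h3 := Nat.mul_le_mul_right Δ hX
  rw [Set.symmDiff_def]
  refine (Set.ncard_union_le _ _).trans ?_
  omega

/-- A sequence of relabelled iterated-path trees through which information spreads slowly. The
nodes at the front of the depth-first order hold the information of odd levels, those at its end
pass it on to the next even level, and it takes `T` rounds to get from the former to the latter. -/
theorem exists_slow_network (d g : ℕ) (hg : 2 ≤ g) {k B T : ℕ} (hk : k = 4 * ((d + 1) * g))
    (hB : B = treeCard k d + 1) (hT : T = g * B) :
    ∃ (graph : ℕ → SimpleGraph (Fin (treeCard k (d + 1))))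
      (level : ℕ → Fin (treeCard k (d + 1)) → ℕ),
      (∀ t, Nonempty (graph t ≃g iteratedPathTree (d + 1) k)) ∧
      (∀ t, (symmDiff (graph t).edgeSet (graph (t + 1)).edgeSet).ncard ≤ 12 * d) ∧
      (∀ t i j, j = i ∨ (graph t).Adj i j → level t j ≤ level (t + 1) i) ∧
      (∀ t i, level t i ≤ 2 * (t / T) + 1) ∧
      (∀ t i, i.val < (d + 1) * T → level t i = 2 * (t / T) + 1) ∧
      (∀ t i, 3 * ((d + 1) * T) ≤ i.val → level t i = 2 * (t / T)) := by
  classical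
  set n := treeCard k (d + 1) with hn
  set H := (d + 1) * T with hH
  have hnH : n = 4 * H := by
    rw [hn, treeCard, ← hB, hk, hH, hT]
    ring
  have hB0 : 1 ≤ B := by omega
  have hT0 : 0 < T := by rw [hT]; exact Nat.mul_pos (by omega) hB0
  -- The shifts reach at most `B + d` beyond a front below `2H`, so the last quarter is never
  -- touched. This needs `g ≥ 2`.
  have hroom : B + d ≤ H := by
    have h1 : (d + 2) * B ≤ H := by
      rw [hH, hT, ← mul_assoc]
      exact Nat.mul_le_mul_right _ (by nlinarith)
    have h2 : (d + 1) * 1 ≤ (d + 1) * B := Nat.mul_le_mul_left _ hB0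
    rw [show (d + 2) * B = (d + 1) * B + B by ring] at h1
    omega
  -- The front starts at `H`, advances by `d + 1` per round and restarts every `T` rounds.
  let m : ℕ → ℕ := fun t => H + (d + 1) * (t % T)
  have hm : ∀ t, m t + (d + 1) ≤ 2 * H := fun t => by
    have h1 : (d + 1) * (t % T + 1) ≤ (d + 1) * T := Nat.mul_le_mul_left _ (Nat.mod_lt t hT0)
    rw [mul_add, mul_one] at h1
    simp only [m]
    omega
  choose shift hs1 hs2 hs3 using fun t => exists_shift d k (m t) (by have := hm t; omega)
  let π : ℕ → Equiv.Perm (Fin n) := fun t => Nat.rec 1 (fun t p => shift t * p) t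
  have hπ : ∀ t, π (t + 1) = shift t * π t := fun t => rfl
  have hfix : ∀ t p, p.val < m t + 1 ∨ 3 * H ≤ p.val → shift t p = p := fun t p hp => by
    by_contra h
    have := hs1 t p h
    have := hm t
    omega
  have hends : ∀ t p, p.val < H ∨ 3 * H ≤ p.val → π t p = p := by
    intro t p hp
    induction t with
    | zero => rfl
    | succ t ih =>
      rw [hπ, Equiv.Perm.mul_apply, ih]
      exact hfix t p (hp.imp_left fun h => by simp only [m]; omega)
  refine ⟨fun t => (posGraph (d + 1) k).comap (π t),
    fun t i => 2 * (t / T) + if (π t i).val < m t then 1 else 0, fun t => ?_, fun t => ?_,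
    fun t i j hij => ?_, fun t i => ?_, fun t i hi => ?_, fun t i hi => ?_⟩
  · exact ⟨(SimpleGraph.Iso.comap (π t) _).trans
      (SimpleGraph.Iso.comap (treeEquiv (d + 1) k).symm _)⟩
  · have hdeg : ∀ v, ((posGraph (d + 1) k).neighborSet v).ncard ≤ 3 :=
      ncard_neighborSet_le_of_iso (SimpleGraph.Iso.comap (treeEquiv (d + 1) k).symm _)
        fun v => (ncard_neighborSet_tree_le k (d + 1) v).1
    have := ncard_symmDiff_edgeSet_comap_le hdeg (π t) (shift t) (hs2 t)
    dsimp only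
    rw [hπ]
    omega
  · dsimp only
    have hdiv : (t + 1) / T = t / T + if T ∣ t + 1 then 1 else 0 := Nat.succ_div
    split_ifs at hdiv with h
    -- At a restart every old level `≤ 2(t/T) + 1` is below the new minimum `2(t/T) + 2`.
    · rw [hdiv]
      split_ifs <;> omega
    · rw [add_zero] at hdiv
      rw [hdiv]
      split_ifs with h1 h2
      · rfl
      · refine absurd ?_ h2
        have hmod : m (t + 1) = m t + (d + 1) := by
          have h3 := Nat.div_add_mod t T
          have h4 := Nat.div_add_mod (t + 1) T
          rw [hdiv] at h4
          have h5 : (t + 1) % T = t % T + 1 := by omega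
          simp only [m, h5]
          ring
        rw [hmod, hπ, Equiv.Perm.mul_apply]
        -- A node already before the front is not moved; a newly reached one is placed before the
        -- next front by the shift.
        by_cases h6 : (π t i).val < m t
        · rw [hfix t _ (.inl (by omega))]
          omega
        · rcases hij with rfl | hij
          · exact absurd h1 h6
          · exact hs3 t _ _ hij.symm h1 (by omega)
      · omega
      · omega
  · dsimp only
    split_ifs <;> omega
  · dsimp only
    rw [hends t i (.inl hi), if_pos (by simp only [m]; omega)]
  · dsimp only
    have := hm t
    rw [hends t i (.inr hi), if_neg (by omega), add_zero]

/-- Only a clock tick can raise a level. Taking `j = i` in `hstep` makes levels monotone, which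
covers local computations that advance the clock. -/
theorem DecentralizedProblem.FirstOrderRun.mem_subset_levelSpace {P : DecentralizedProblem}
    (A : P.FirstOrderRun) {level : ℕ → Fin P.n → ℕ}
    (hstep : ∀ t i j, j = i ∨ (P.graph t).Adj i j → level t j ≤ level (t + 1) i)
    (hgrad : ∀ t i, ∀ x ∈ levelSpace (level t i), gradient (P.f i) x ∈ levelSpace (level t i))
    (hconj : ∀ t i, ∀ x ∈ levelSpace (level t i),
      gradient (fenchelConjugate (P.f i)) x ∈ levelSpace (level t i)) (p : ℕ) :
    ∀ i, A.mem p i ⊆ levelSpace (level (A.clock p) i) := by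
  induction p with
  | zero =>
    intro i
    rw [A.mem_zero]
    exact Set.singleton_subset_iff.2 (Submodule.zero_mem _)
  | succ p ih =>
    intro i
    by_cases hp : p ∈ A.comm
    · rw [A.clock_comm p hp]
      refine (A.mem_comm p hp i).trans (Submodule.span_le.2 ?_)
      rintro z ⟨j, hj, hz⟩
      exact levelSpace_mono (hstep _ i j hj) (ih j hz)
    · have hle : level (A.clock p) i ≤ level (A.clock (p + 1)) i := by
        rcases A.clock_local p hp with h | h
        · rw [h]
        · rw [h]
          exact hstep _ i i (.inl rfl)
      refine (A.mem_local p hp i).trans (Submodule.span_le.2 ?_)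
      rintro z ⟨x, hx, rfl | rfl | rfl⟩
      · exact levelSpace_mono hle (ih i hx)
      · exact levelSpace_mono hle (hgrad _ i x (ih i hx))
      · exact levelSpace_mono hle (hconj _ i x (ih i hx))

/-! ### Averages of quadratic functions. -/

section Average

variable {n : ℕ} {A : Fin n → EllTwo →L[ℝ] EllTwo} {c : Fin n → EllTwo}

theorem average_quadraticFun (x : EllTwo) :
    (1 / (n : ℝ)) * ∑ i, quadraticFun (A i) (c i) x =
      quadraticFun ((1 / (n : ℝ)) • ∑ i, A i) ((1 / (n : ℝ)) • ∑ i, c i) x := by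
  simp only [quadraticFun, smul_apply, sum_apply,
    real_inner_smul_left, sum_inner, Finset.sum_sub_distrib, ← Finset.mul_sum]
  ring

theorem inner_average_left (hA : ∀ i x y, inner ℝ (A i x) y = inner ℝ x (A i y)) (x y : EllTwo) :
    inner ℝ (((1 / (n : ℝ)) • ∑ i, A i) x) y = inner ℝ x (((1 / (n : ℝ)) • ∑ i, A i) y) := by
  simp only [smul_apply, sum_apply, real_inner_smul_left,
    real_inner_smul_right, sum_inner, inner_sum, hA]

theorem le_inner_average (hn : 0 < n) {μ : ℝ} (hA : ∀ i x, μ * ‖x‖ ^ 2 ≤ inner ℝ (A i x) x)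
    (x : EllTwo) : μ * ‖x‖ ^ 2 ≤ inner ℝ (((1 / (n : ℝ)) • ∑ i, A i) x) x := by
  have hn' : (0 : ℝ) < n := Nat.cast_pos.2 hn
  have h := Finset.card_nsmul_le_sum Finset.univ _ _ fun i _ => hA i x
  rw [Finset.card_univ, Fintype.card_fin, nsmul_eq_mul] at h
  simp only [smul_apply, sum_apply, real_inner_smul_left,
    sum_inner]
  rw [one_div, inv_mul_eq_div, le_div_iff₀ hn']
  linarith

theorem norm_average_le (hn : 0 < n) {L : ℝ} (hA : ∀ i, ‖A i‖ ≤ L) :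
    ‖(1 / (n : ℝ)) • ∑ i, A i‖ ≤ L := by
  have hn' : (0 : ℝ) < n := Nat.cast_pos.2 hn
  rw [norm_smul, Real.norm_of_nonneg (by positivity), one_div, inv_mul_eq_div, div_le_iff₀ hn']
  refine (norm_sum_le _ _).trans ((Finset.sum_le_card_nsmul _ _ _ fun i _ => hA i).trans ?_)
  rw [Finset.card_univ, Fintype.card_fin, nsmul_eq_mul, mul_comm]

end Average

theorem sum_fin_front_end {n H : ℕ} (hn : n = 4 * H) (F : Fin n → ℝ) {α β δ : ℝ}
    (h1 : ∀ i, i.val < H → F i = α) (h2 : ∀ i, H ≤ i.val → i.val < 3 * H → F i = δ)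
    (h3 : ∀ i, 3 * H ≤ i.val → F i = β) : ∑ i, F i = H * (α + β + 2 * δ) := by
  have hF : ∀ i : Fin n, F i = if i.val < H then α else if i.val < 3 * H then δ else β := by
    intro i
    split_ifs with ha hb
    · exact h1 i ha
    · exact h2 i (not_lt.1 ha) hb
    · exact h3 i (not_lt.1 hb)
  rw [Finset.sum_congr rfl fun i _ => hF i,
    Fin.sum_univ_eq_sum_range (fun i => if i < H then α else if i < 3 * H then δ else β),
    show n = H + 2 * H + H by omega, Finset.sum_range_add, Finset.sum_range_add]
  have e1 : ∑ i ∈ Finset.range H, (if i < H then α else if i < 3 * H then δ else β) = H * α := by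
    rw [Finset.sum_congr rfl (g := fun _ => α) fun i hi => if_pos (Finset.mem_range.1 hi)]
    simp
  have e2 : ∑ i ∈ Finset.range (2 * H),
      (if H + i < H then α else if H + i < 3 * H then δ else β) = (2 * H : ℕ) * δ := by
    rw [Finset.sum_congr rfl (g := fun _ => δ) fun i hi => by
      have := Finset.mem_range.1 hi
      rw [if_neg (by omega), if_pos (by omega)]]
    simp
  have e3 : ∑ i ∈ Finset.range H, (if H + 2 * H + i < H then α else
      if H + 2 * H + i < 3 * H then δ else β) = H * β := by
    rw [Finset.sum_congr rfl (g := fun _ => β) fun i hi => by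
      rw [if_neg (by omega), if_neg (by omega)]]
    simp
  rw [e1, e2, e3]
  push_cast
  ring

/-! ### The decay rate and the numerical constants. -/

/-- With `b = (L - μ)/8` the equation reads `2 sinh (u/2) = √(μ/b)`, and `arsinh s ≤ s` gives `u ≤
√(μ/b)`. -/
theorem exists_decay_rate {L μ : ℝ} (hμ : 0 < μ) (hL : 24 * μ < L) :
    ∃ u : ℝ, 0 < u ∧ u ≤ 3 * √(μ / L) ∧
      (L - μ) / 8 * (1 - Real.exp (-u)) ^ 2 = μ * Real.exp (-u) := by
  have hb : 0 < (L - μ) / 8 := by linarith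
  set b := (L - μ) / 8
  set s := √(μ / b) / 2
  have hs : 0 < s := by positivity
  have hs2 : s ^ 2 = μ / b / 4 := by
    rw [div_pow, Real.sq_sqrt (by positivity)]
    norm_num
  refine ⟨2 * Real.arsinh s, by have := Real.arsinh_pos_iff.2 hs; positivity, ?_, ?_⟩
  · have h1 : Real.arsinh s ≤ s := by
      conv_rhs => rw [← Real.sinh_arsinh s]
      exact Real.self_le_sinh_iff.2 (Real.arsinh_nonneg_iff.2 hs.le)
    have h2 : √(μ / b) ≤ 3 * √(μ / L) := by
      rw [show (3 : ℝ) = √9 by rw [show (9 : ℝ) = 3 ^ 2 by norm_num, Real.sqrt_sq (by norm_num)],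
        ← Real.sqrt_mul (by norm_num)]
      refine Real.sqrt_le_sqrt ?_
      rw [mul_div_assoc', div_le_div_iff₀ hb (by linarith)]
      simp only [b]
      nlinarith
    calc 2 * Real.arsinh s ≤ 2 * s := by linarith
      _ = √(μ / b) := by ring
      _ ≤ _ := h2
  · set v := Real.arsinh s
    have h1 : Real.exp (-(2 * v)) = Real.exp (-v) ^ 2 := by
      rw [← Real.exp_nat_mul]
      congr 1
      push_cast
      ring
    have h2 : 1 - Real.exp (-(2 * v)) = 2 * Real.exp (-v) * s := by
      rw [← Real.sinh_arsinh s, Real.sinh_eq, h1]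
      have : Real.exp (-v) * Real.exp v = 1 := by rw [← Real.exp_add]; simp
      linear_combination (-1 : ℝ) * this
    rw [h2, mul_pow, mul_pow, hs2, h1]
    field_simp
    ring

/-- With `e = d + 1`, raise the bound on `χ` to the power `e` and replace `k ^ e` by `n ≤ 12en`;
then take the root of order `e + 1`. -/
theorem rpow_chi_le {d n k T : ℕ} {χ : ℝ} (h0 : 0 ≤ χ) (hn : n = 4 * ((d + 1) * T))
    (hk : k ^ (d + 1) ≤ n) (hχ : χ ≤ 12 * (d + 1) * n * k) :
    χ ^ (((d + 1 : ℕ) : ℝ) / (((d + 1 : ℕ) : ℝ) + 1)) ≤ 48 * (d + 1) ^ 2 * T := by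
  set e : ℝ := ((d + 1 : ℕ) : ℝ) with he
  have hd : (d : ℝ) + 1 = e := by rw [he]; push_cast; ring
  have he0 : 1 ≤ e := by rw [← hd]; linarith [(Nat.cast_nonneg d : (0 : ℝ) ≤ d)]
  rw [hd] at hχ ⊢
  have hn' : (n : ℝ) = 4 * (e * T) := by rw [hn, ← hd]; push_cast; ring
  have hn0 : (0 : ℝ) ≤ n := Nat.cast_nonneg n
  have hk0 : (0 : ℝ) ≤ k := Nat.cast_nonneg k
  have h1 : (k : ℝ) ^ e ≤ n := by
    rw [he, Real.rpow_natCast]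
    exact_mod_cast hk
  have h2 : (12 * e * n * k) ^ e ≤ (12 * e * n) ^ (e + 1) := by
    rcases hn0.eq_or_lt with h | h
    · rw [← h]
      simp only [mul_zero, zero_mul]
      rw [Real.zero_rpow (by linarith), Real.zero_rpow (by linarith)]
    · have h3 : 0 < 12 * e * n := by positivity
      rw [Real.mul_rpow h3.le hk0, Real.rpow_add h3, Real.rpow_one]
      refine mul_le_mul_of_nonneg_left (h1.trans ?_) (by positivity)
      nlinarith
  calc χ ^ (e / (e + 1)) = (χ ^ e) ^ (e + 1)⁻¹ := by rw [← Real.rpow_mul h0, div_eq_mul_inv]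
    _ ≤ ((12 * e * n) ^ (e + 1)) ^ (e + 1)⁻¹ :=
      Real.rpow_le_rpow (by positivity) ((Real.rpow_le_rpow h0 hχ (by linarith)).trans h2)
        (by positivity)
    _ = 12 * e * n := Real.rpow_rpow_inv (by positivity) (by linarith)
    _ = 48 * e ^ 2 * T := by rw [hn']; ring

theorem rpow_bound_of_exp_bound {L μ u K X T : ℝ} {c : ℕ} (hT : 0 < T) (hX : 0 < X)
    (hK : 4 * X ≤ K * T) (hu0 : 0 < u) (hu : u ≤ 3 * √(μ / L)) {δ χ : ℝ} (hχ : 0 ≤ χ)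
    (hXχ : X = χ ^ δ) :
    (max 0 (1 - 2 * √6 * √(μ / L))) ^ (K * (c : ℝ) * χ ^ (-δ) + 2) ≤
      Real.exp (-u * (4 * (c / T) + 2)) := by
  have hc : (0 : ℝ) ≤ c := Nat.cast_nonneg c
  have h6 : (3 : ℝ) ≤ 2 * √6 := by
    have : (2 : ℝ) ≤ √6 := Real.le_sqrt_of_sq_le (by norm_num)
    linarith
  have hbase : max 0 (1 - 2 * √6 * √(μ / L)) ≤ Real.exp (-u) := by
    refine max_le (Real.exp_pos _).le ?_
    have h1 := Real.add_one_le_exp (-u)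
    have h2 := mul_le_mul_of_nonneg_right h6 (Real.sqrt_nonneg (μ / L))
    linarith
  have hexp : 4 * (c / T) + 2 ≤ K * c * χ ^ (-δ) + 2 := by
    rw [Real.rpow_neg hχ, ← hXχ, ← div_eq_mul_inv, mul_div_assoc', add_le_add_iff_right,
      div_le_div_iff₀ hT hX]
    nlinarith
  have hpos : 0 ≤ 4 * (c / T) + 2 := by positivity
  refine (Real.rpow_le_rpow (le_max_left _ _) hbase (hpos.trans hexp)).trans ?_
  rw [← Real.exp_mul, Real.exp_le_exp]
  exact mul_le_mul_of_nonpos_left hexp (by linarith)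

theorem clock_bound_of_exp_bound {L μ u X T c₀ c ε : ℝ} (hμ : 0 < μ) (hL : 24 * μ < L)
    (hT : 0 < T) (hX : 24 * (c₀ * X) ≤ T) (hc : 0 ≤ c)
    (hu : u ≤ 3 * √(μ / L)) (hε : 0 < ε) (hε4 : ε ≤ Real.exp (-4))
    (h : Real.exp (-u * (4 * (c / T) + 2)) ≤ ε) :
    c₀ * X * √(L / μ) * Real.log (1 / ε) ≤ c := by
  set Λ := Real.log (1 / ε) with hΛ
  have hlog : Λ = -Real.log ε := by rw [hΛ, one_div, Real.log_inv]
  have hΛ4 : 4 ≤ Λ := by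
    have := (Real.log_le_iff_le_exp hε).2 hε4
    linarith
  have h1 : Λ ≤ u * (4 * (c / T) + 2) := by
    have := (Real.le_log_iff_exp_le hε).2 h
    linarith
  set s := √(μ / L)
  have hL0 : 0 < L := by linarith
  have hs : s * √(L / μ) = 1 := by
    rw [← Real.sqrt_mul (by positivity), div_mul_div_cancel₀ hL0.ne', div_self hμ.ne',
      Real.sqrt_one]
  have hs3 : 3 * s ≤ 1 := by
    have h2 : s ≤ 1 / 3 := Real.sqrt_le_iff.2 ⟨by norm_num, by rw [div_le_iff₀ hL0]; linarith⟩
    linarith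
  have hcT : 0 ≤ c / T := by positivity
  have h3 : Λ ≤ 3 * s * (4 * (c / T) + 2) :=
    h1.trans (mul_le_mul_of_nonneg_right hu (by linarith))
  -- The summand `6s ≤ 2` is absorbed into `Λ/2`; this is where `ε ≤ exp (-4)` enters.
  have h4 : Λ ≤ 24 * s * (c / T) := by nlinarith
  have h5 : √(L / μ) * Λ ≤ 24 * (c / T) := by
    have := mul_le_mul_of_nonneg_left h4 (Real.sqrt_nonneg (L / μ))
    calc _ ≤ _ := this
      _ = s * √(L / μ) * (24 * (c / T)) := by ring
      _ = _ := by rw [hs, one_mul]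
  have h6 : T * (√(L / μ) * Λ) ≤ 24 * c := by
    have := mul_le_mul_of_nonneg_left h5 hT.le
    calc _ ≤ _ := this
      _ = _ := by field_simp
  have h7 : 0 ≤ √(L / μ) * Λ := by positivity
  have := mul_le_mul_of_nonneg_right hX h7
  linarith

/-! ### The hard objective functions and their average. -/

section HardFunctions

/-- The pairs of coordinates that the objective function of a node couples. -/
def nodeSwap (H i : ℕ) : Equiv.Perm ℕ :=
  if i < H then oddSwap else if 3 * H ≤ i then evenSwap else 1

/-- The quadratic part of the hard objective function of a node. -/
noncomputable def nodeOp (μ a : ℝ) (H i : ℕ) : EllTwo →L[ℝ] EllTwo := swapOp μ a (nodeSwap H i)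

/-- The linear part of the hard objective function of a node. -/
noncomputable def nodeVec (γ : ℝ) (H i : ℕ) : EllTwo := if i < H then lp.single 2 0 γ else 0

theorem involutive_nodeSwap (H i : ℕ) : Function.Involutive (nodeSwap H i) := by
  unfold nodeSwap
  split_ifs
  · exact involutive_oddSwap
  · exact involutive_evenSwap
  · exact fun _ => rfl

theorem node_levelSpace {μ a γ : ℝ} {H i r l : ℕ} (h1 : i < H → l = 2 * r + 1)
    (h2 : 3 * H ≤ i → l = 2 * r) :
    (∀ x ∈ levelSpace l, nodeOp μ a H i x ∈ levelSpace l) ∧ nodeVec γ H i ∈ levelSpace l := by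
  constructor
  · intro x hx
    refine swapOp_mem_levelSpace (fun j hj => ?_) hx
    unfold nodeSwap
    split_ifs with ha hb
    · rw [h1 ha] at hj ⊢
      exact le_oddSwap hj
    · rw [h2 hb] at hj ⊢
      exact le_evenSwap hj
    · exact hj
  · unfold nodeVec
    split_ifs with ha
    · exact single_zero_mem_levelSpace (by rw [h1 ha]; omega) γ
    · exact Submodule.zero_mem _

theorem average_node_apply_geomSeq {n H : ℕ} (hn : n = 4 * H) (hH : 0 < H) {μ a q : ℝ}
    (h0 : 0 ≤ q) (h1 : q < 1) (hq : a / 4 * (1 - q) ^ 2 = μ * q) :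
    ((1 / (n : ℝ)) • ∑ i : Fin n, nodeOp μ a H i) (geomSeq h0 h1) =
      (1 / (n : ℝ)) • ∑ i : Fin n, nodeVec (4 * (μ + a / 4 * (1 - q))) H i := by
  have hH' : (H : ℝ) ≠ 0 := Nat.cast_ne_zero.2 hH.ne'
  have hn' : (n : ℝ) = 4 * H := by rw [hn]; push_cast; ring
  refine lp.ext (funext fun j => ?_)
  have hop : (((1 / (n : ℝ)) • ∑ i : Fin n, nodeOp μ a H i) (geomSeq h0 h1) : EllTwo) j =
      (1 / (n : ℝ)) * ∑ i : Fin n, nodeOp μ a H i (geomSeq h0 h1) j := by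
    rw [smul_apply, sum_apply, lp.coeFn_smul, Pi.smul_apply, lp.coeFn_sum, Finset.sum_apply,
      smul_eq_mul]
  have hvec : ((1 / (n : ℝ)) • ∑ i : Fin n, nodeVec (4 * (μ + a / 4 * (1 - q))) H i : EllTwo) j =
      (1 / (n : ℝ)) * ∑ i : Fin n, nodeVec (4 * (μ + a / 4 * (1 - q))) H i j := by
    rw [lp.coeFn_smul, Pi.smul_apply, lp.coeFn_sum, Finset.sum_apply, smul_eq_mul]
  rw [hop, hvec]
  rw [sum_fin_front_end hn (fun i => nodeOp μ a H i (geomSeq h0 h1) j)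
      (α := (μ + a) * q ^ j - a * q ^ oddSwap j) (β := (μ + a) * q ^ j - a * q ^ evenSwap j)
      (δ := (μ + a) * q ^ j - a * q ^ j)
      (fun i hi => by rw [nodeOp, nodeSwap, if_pos hi]; rfl)
      (fun i hi hi' => by rw [nodeOp, nodeSwap, if_neg (by omega), if_neg (by omega)]; rfl)
      (fun i hi => by rw [nodeOp, nodeSwap, if_neg (by omega), if_pos hi]; rfl),
    sum_fin_front_end hn (fun i => nodeVec (4 * (μ + a / 4 * (1 - q))) H i j)
      (α := (lp.single 2 0 (4 * (μ + a / 4 * (1 - q))) : EllTwo) j) (β := 0) (δ := 0)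
      (fun i hi => by rw [nodeVec, if_pos hi])
      (fun i hi hi' => by rw [nodeVec, if_neg (by omega)]; rfl)
      (fun i hi => by rw [nodeVec, if_neg (by omega)]; rfl), hn', evenSwap_apply, oddSwap_apply]
  rcases j with _ | j
  · rw [lp.single_apply_self]
    simp only [if_true, pow_zero, Nat.zero_mod, zero_add, pow_one]
    field_simp
    ring
  · rw [lp.single_apply_ne 2 0 _ (Nat.succ_ne_zero j)]
    -- For `j + 1 ≥ 1` one swap leads to the left neighbour and the other to the right one, in an
    -- order depending on parity.
    have hsum : q ^ (if j + 1 = 0 then 0 else if (j + 1) % 2 = 0 then j + 1 - 1 else j + 1 + 1) +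
        q ^ (if (j + 1) % 2 = 0 then j + 1 + 1 else j + 1 - 1) = q ^ j + q ^ (j + 2) := by
      rw [if_neg (Nat.succ_ne_zero j)]
      split_ifs
      · rfl
      · rw [add_comm]
        rfl
    field_simp
    linear_combination (-a) * hsum - 4 * q ^ j * hq

end HardFunctions

/-! ### Choice of the parameters and assembly. -/

theorem exists_network (d : ℕ) (M : ℝ) :
    ∃ (n k T : ℕ) (graph : ℕ → SimpleGraph (Fin n)) (level : ℕ → Fin n → ℕ),
      0 < T ∧ n = 4 * ((d + 1) * T) ∧ k ^ (d + 1) ≤ n ∧ M < n ∧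
      (∀ t, (graph t).Connected) ∧
      (∀ t, Nonempty (graph t ≃g iteratedPathTree (d + 1) k)) ∧
      (⨆ t, (symmDiff (graph t).edgeSet (graph (t + 1)).edgeSet).ncard) ≤ 12 * d ∧
      M < ⨆ t, graphCondition (graph t) ∧ 0 < ⨆ t, graphCondition (graph t) ∧
      (⨆ t, graphCondition (graph t)) ≤ 12 * (d + 1) * n * k ∧
      (∀ t i j, j = i ∨ (graph t).Adj i j → level t j ≤ level (t + 1) i) ∧
      (∀ t i, level t i ≤ 2 * (t / T) + 1) ∧
      (∀ t i, i.val < (d + 1) * T → level t i = 2 * (t / T) + 1) ∧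
      (∀ t i, 3 * ((d + 1) * T) ≤ i.val → level t i = 2 * (t / T)) := by
  set g := max 2 (⌊M⌋₊ + 1)
  have hg : 2 ≤ g := le_max_left _ _
  have hMg : M < g := (Nat.lt_floor_add_one M).trans_le (by exact_mod_cast le_max_right _ _)
  set k := 4 * ((d + 1) * g) with hk
  have hgk : 4 * g ≤ k := by rw [hk]; nlinarith
  have hk0 : 0 < k := by omega
  obtain ⟨graph, level, hiso, hdiff, hstep, hle, hfront, hend⟩ :=
    exists_slow_network d g hg hk rfl rfl
  set T := g * (treeCard k d + 1) with hT
  have hn : treeCard k (d + 1) = 4 * ((d + 1) * T) := by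
    rw [treeCard, hT]
    nth_rewrite 1 [hk]
    ring
  have hkn : k ^ (d + 1) ≤ treeCard k (d + 1) := pow_le_treeCard k (d + 1) (by omega)
  have hkn1 : k ≤ treeCard k (d + 1) := (Nat.le_self_pow (Nat.succ_ne_zero d) k).trans hkn
  have hup : ∀ t, graphCondition (graph t) ≤ 12 * (d + 1) * treeCard k (d + 1) * k := fun t =>
    (hiso t).elim fun e => graphCondition_le_of_iso hk0 e
  have hlow : (k : ℝ) - 1 ≤ 2 * ⨆ t, graphCondition (graph t) := by
    have h1 := (hiso 0).elim fun e => le_two_mul_graphCondition (by omega) e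
    have h2 := le_ciSup (f := fun t => graphCondition (graph t))
      ⟨_, Set.forall_mem_range.2 hup⟩ 0
    linarith
  have hgk' : 4 * (g : ℝ) ≤ k := by exact_mod_cast hgk
  have hg' : (2 : ℝ) ≤ g := by exact_mod_cast hg
  have hkn' : (k : ℝ) ≤ treeCard k (d + 1) := by exact_mod_cast hkn1
  refine ⟨_, k, T, graph, level, Nat.mul_pos (by omega) (Nat.succ_pos _), hn, hkn, by linarith,
    fun t => ?_, hiso, ciSup_le' hdiff, by linarith, by linarith, ciSup_le hup, hstep, hle, hfront,
    hend⟩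
  exact (hiso t).elim fun e => e.connected_iff.2 (connected_iteratedPathTree hk0 d)

theorem base_eq_zero {L μ : ℝ} (hμ : 0 < μ) (hμL : μ ≤ L) (hL : L ≤ 24 * μ) :
    max 0 (1 - 2 * √6 * √(μ / L)) = 0 := by
  have hL0 : 0 < L := hμ.trans_le hμL
  have h1 : √(1 / 24) ≤ √(μ / L) :=
    Real.sqrt_le_sqrt (by rw [div_le_div_iff₀ (by norm_num) hL0]; linarith)
  have h2 : 2 * √6 * √(1 / 24) = 1 := by
    rw [show (2 : ℝ) = √4 by rw [show (4 : ℝ) = 2 ^ 2 by norm_num, Real.sqrt_sq (by norm_num)],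
      ← Real.sqrt_mul (by norm_num), ← Real.sqrt_mul (by norm_num)]
    norm_num
  have := mul_le_mul_of_nonneg_left h1 (by positivity : 0 ≤ 2 * √6)
  exact max_eq_left (by linarith)

theorem theorem3 (d : ℕ) (hd : 1 ≤ d) :
    ∃ K c ε₀ : ℝ, 0 < K ∧ 0 < c ∧ 0 < ε₀ ∧
      ∀ L μ M : ℝ, 0 < μ → μ ≤ L →
        ∃ P : DecentralizedProblem,
          -- the objective functions
          (∀ i, LSmooth L (P.f i) ∧ MuStronglyConvex μ (P.f i)) ∧
          LSmooth L P.globalFun ∧ MuStronglyConvex μ P.globalFun ∧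
          -- the network
          M < (P.n : ℝ) ∧ M < P.chi ∧ P.maxChange ≤ 12 * (d - 1) ∧
          (∃ k : ℕ, ∀ t : ℕ, Nonempty (P.graph t ≃g iteratedPathTree d k)) ∧
          -- the lower bounds, for the minimizer of the global function
          ∃ xs : EllTwo, (∀ y, P.globalFun xs ≤ P.globalFun y) ∧ xs ≠ 0 ∧
            (∀ (A : P.FirstOrderRun) (p : ℕ) (i : Fin P.n), ∀ x ∈ A.mem p i,
              (max 0 (1 - 2 * √6 * √(μ / L))) ^
                  (K * (A.clock p : ℝ) * P.chi ^ (-((d : ℝ) / ((d : ℝ) + 1))) + 2) *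
                ‖(0 : EllTwo) - xs‖ ^ 2 ≤ ‖x - xs‖ ^ 2) ∧
            (24 * μ < L →
              ∀ (A : P.FirstOrderRun) (p : ℕ) (i : Fin P.n), ∀ x ∈ A.mem p i,
                ∀ ε : ℝ, 0 < ε → ε ≤ ε₀ →
                  ‖x - xs‖ ^ 2 ≤ ε * ‖(0 : EllTwo) - xs‖ ^ 2 →
                  c * P.chi ^ ((d : ℝ) / ((d : ℝ) + 1)) * √(L / μ) * Real.log (1 / ε) ≤
                    (A.clock p : ℝ)) := by
  obtain ⟨d, rfl⟩ := Nat.exists_eq_add_of_le' hd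
  -- From `χ ^ (D/(D+1)) ≤ 48 (d + 1)² T`: `192 = 4 · 48` for the four in the exponent `4c/T + 2`,
  -- and `1152 = 24 · 48` for `clock_bound_of_exp_bound`.
  refine ⟨192 * (d + 1) ^ 2, 1 / (1152 * (d + 1) ^ 2), Real.exp (-4), by positivity, by positivity,
    Real.exp_pos _, fun L μ M hμ hμL => ?_⟩
  obtain ⟨n, k, T, graph, level, hT, hn, hkn, hMn, hconn, hiso, hdiff, hMχ, hχ0, hχ, hstep, hle,
    hfront, hend⟩ := exists_network d M
  set H := (d + 1) * T
  have hH : 0 < H := Nat.mul_pos (Nat.succ_pos d) hT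
  have hn0 : 0 < n := by omega
  -- For `L ≤ 24μ` the base of the power is `0` and its exponent positive, so any problem with a
  -- nonzero minimizer will do.
  by_cases hL : 24 * μ < L
  swap
  · have hsym : ∀ x y, inner ℝ (swapOp μ 0 1 x) y = inner ℝ x (swapOp μ 0 1 y) :=
      inner_swapOp_left fun _ => rfl
    have hcoer := le_inner_swapOp (μ := μ) le_rfl 1
    have hnorm : ‖swapOp μ 0 1‖ ≤ L := (norm_swapOp_le hμ.le le_rfl 1).trans (by linarith)
    let f := quadraticFun (swapOp μ 0 1) (lp.single 2 0 μ)
    let P : DecentralizedProblem := ⟨n, graph, hconn, fun _ => f⟩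
    have hglob : P.globalFun = f := by
      funext x
      have hn' : (n : ℝ) ≠ 0 := Nat.cast_ne_zero.2 hn0.ne'
      simp [DecentralizedProblem.globalFun, P, hn']
    have hmin : swapOp μ 0 1 (lp.single 2 0 1) = lp.single 2 0 μ := by
      rw [swapOp_apply, zero_smul, sub_zero, add_zero, ← lp.single_smul]
      simp
    refine ⟨P, fun _ => ⟨lSmooth_quadraticFun hsym hnorm, muStronglyConvex_quadraticFun hsym hcoer⟩,
      hglob ▸ lSmooth_quadraticFun hsym hnorm, hglob ▸ muStronglyConvex_quadraticFun hsym hcoer,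
      hMn, hMχ, hdiff, ⟨k, hiso⟩, lp.single 2 0 1, fun y => ?_, fun h => ?_,
      fun A p i x _ => ?_, fun h => absurd h hL⟩
    · rw [hglob]
      exact quadraticFun_le_of_apply_eq hμ.le hsym hcoer hmin y
    · have := congrArg (fun x : EllTwo => x 0) h
      simp at this
    · rw [base_eq_zero hμ hμL (not_lt.1 hL), Real.zero_rpow, zero_mul]
      · positivity
      · have : 0 ≤ P.chi := hχ0.le
        positivity
  · obtain ⟨u, hu0, hu, hq⟩ := exists_decay_rate hμ hL
    set q := Real.exp (-u)
    have hq0 : 0 ≤ q := (Real.exp_pos _).le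
    have hq1 : q < 1 := Real.exp_zero ▸ Real.exp_lt_exp.2 (by linarith)
    -- This makes the norm bound `μ + 2a` of the swap operators equal to `L`.
    set a := (L - μ) / 2
    have ha : 0 ≤ a := by simp only [a]; linarith
    have haq : a / 4 * (1 - q) ^ 2 = μ * q := by rw [← hq]; simp only [a]; ring
    -- Forced by coordinate `0` of the optimality equation; the factor `4` appears because a quarter
    -- of the nodes carry the linear term.
    set γ := 4 * (μ + a / 4 * (1 - q))
    have hsym : ∀ (i : Fin n) x y,
        inner ℝ (nodeOp μ a H i x) y = inner ℝ x (nodeOp μ a H i y) := fun i =>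
      inner_swapOp_left (involutive_nodeSwap H i)
    have hcoer : ∀ (i : Fin n) x, μ * ‖x‖ ^ 2 ≤ inner ℝ (nodeOp μ a H i x) x := fun i =>
      le_inner_swapOp ha _
    have hnorm : ∀ i : Fin n, ‖nodeOp μ a H i‖ ≤ L := fun i =>
      (norm_swapOp_le hμ.le ha _).trans (by simp only [a]; linarith)
    let P : DecentralizedProblem :=
      ⟨n, graph, hconn, fun i => quadraticFun (nodeOp μ a H i) (nodeVec γ H i)⟩
    have hglob : P.globalFun = quadraticFun ((1 / (n : ℝ)) • ∑ i : Fin n, nodeOp μ a H i)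
        ((1 / (n : ℝ)) • ∑ i : Fin n, nodeVec γ H i) := funext average_quadraticFun
    have hsym' := inner_average_left hsym
    have hcoer' := le_inner_average hn0 hcoer
    have hmin := average_node_apply_geomSeq hn hH hq0 hq1 haq
    have hlev : ∀ t (i : Fin n), (∀ x ∈ levelSpace (level t i),
        nodeOp μ a H i x ∈ levelSpace (level t i)) ∧ nodeVec γ H i ∈ levelSpace (level t i) :=
      fun t i => node_levelSpace (hfront t i) (hend t i)
    have hTr : (0 : ℝ) < T := Nat.cast_pos.2 hT
    have hbound : ∀ (A : P.FirstOrderRun) (p : ℕ) (i : Fin P.n), ∀ x ∈ A.mem p i,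
        Real.exp (-u * (4 * (A.clock p / T) + 2)) * ‖(0 : EllTwo) - geomSeq hq0 hq1‖ ^ 2 ≤
          ‖x - geomSeq hq0 hq1‖ ^ 2 := by
      intro A p i x hx
      have hmem := A.mem_subset_levelSpace hstep
        (fun t i x hx => by
          rw [gradient_quadraticFun (hsym i)]
          exact Submodule.sub_mem _ ((hlev t i).1 x hx) (hlev t i).2)
        (fun t i x hx => gradient_fenchelConjugate_mem hμ (hsym i) (hcoer i) _ (hlev t i).1
          (hlev t i).2 hx) p i hx
      have h1 := le_norm_sub_geomSeq hq0 hq1 (levelSpace_mono (hle _ i) hmem)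
      rw [zero_sub, norm_neg]
      refine (mul_le_mul_of_nonneg_right ?_ (sq_nonneg _)).trans h1
      rw [← Real.exp_nat_mul, Real.exp_le_exp]
      have h2 : ((A.clock p / T : ℕ) : ℝ) ≤ A.clock p / T := Nat.cast_div_le
      push_cast
      nlinarith
    set δ := ((d + 1 : ℕ) : ℝ) / (((d + 1 : ℕ) : ℝ) + 1)
    have hX : P.chi ^ δ ≤ 48 * (d + 1) ^ 2 * T := rpow_chi_le hχ0.le hn hkn hχ
    have hX0 : 0 < P.chi ^ δ := Real.rpow_pos_of_pos hχ0 _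
    have hxs := geomSeq_ne_zero hq0 hq1
    refine ⟨P, fun i => ⟨lSmooth_quadraticFun (hsym i) (hnorm i),
      muStronglyConvex_quadraticFun (hsym i) (hcoer i)⟩,
      hglob ▸ lSmooth_quadraticFun hsym' (norm_average_le hn0 hnorm),
      hglob ▸ muStronglyConvex_quadraticFun hsym' hcoer',
      hMn, hMχ, hdiff, ⟨k, hiso⟩, geomSeq hq0 hq1, fun y => ?_, hxs,
      fun A p i x hx => ?_, fun _ A p i x hx ε hε hε4 h => ?_⟩
    · rw [hglob]
      exact quadraticFun_le_of_apply_eq hμ.le hsym' hcoer' hmin y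
    · refine le_trans (mul_le_mul_of_nonneg_right ?_ (sq_nonneg _)) (hbound A p i x hx)
      exact rpow_bound_of_exp_bound hTr hX0 (by linarith) hu0 hu hχ0.le rfl
    · have hpos : 0 < ‖(0 : EllTwo) - geomSeq hq0 hq1‖ ^ 2 := by
        rw [zero_sub, norm_neg]
        exact pow_pos (norm_pos_iff.2 hxs) 2
      refine clock_bound_of_exp_bound hμ hL hTr ?_ (Nat.cast_nonneg _) hu hε hε4
        (le_of_mul_le_mul_right ((hbound A p i x hx).trans h) hpos)
      rw [← mul_assoc, mul_one_div, div_mul_eq_mul_div, div_le_iff₀ (by positivity)]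
      linarith
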